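/- **Conventions.** $H^{N-1}$ is the $(N-1)$-dimensional Hausdorff measure on $\mathbb R^N$ (normalised as usual). Let $\Omega\subset\mathbb R^N$ be open. A *Lipschitz chart* of $\Omega$ consists of orthonormal coordinates $x=(x',t)\in\mathbb R^{N-1}\times\mathbb R$, a Lipschitz function $\varphi:\mathbb R^{N-1}\to\mathbb R$ and an open set $U$ such that $\Omega\cap U=\{x\in U:\ t>\varphi(x')\}$. $\Omega$ is *Lipschitz at* $x$ if some chart has $x\in U$; it is a *Lipschitz open set* if it is Lipschitz at every $x\in\partial\Omega$. If $x\in\partial\Omega\cap U$ and $\varphi$ is differentiable at $x'$, the *explicit chart (Nečas) inner normal* at $x$ is $\nu_2(x)=\dfrac{(-\nabla\varphi(x'),1)}{\sqrt{1+|\nabla\varphi(x')|^2}}$, written back in the original coordinates. A finite $\mathbb R^N$-valued Borel measure $D$ is the distributional gradient $D\chi_\Omega$ if $\int_\Omega \operatorname{div}u\,dx=-\int u\cdot dD$ for all $u\in C^1_c(\mathbb R^N,\mathbb R^N)$; $|D|$ is its total variation. The *reduced boundary* is the set of $x\in\operatorname{supp}|D|$ at which $\nu_1(x)=\lim_{r\downarrow0}D(B_r(x))/|D|(B_r(x))$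 exists and has norm $1$; $\nu_1$ is the *measure-theoretic (De Giorgi, Fusco) inner normal*. **(A)** Let $N\ge1$ and let $\Omega\subset\mathbb R^N$ be a Lipschitz open set with $H^{N-1}(\partial\Omega)<\infty$. Then $D\chi_\Omega$ exists and is unique, and 1. $|D\chi_\Omega|=H^{N-1}\lfloor\partial\Omega$; the reduced boundary is contained in $\partial\Omega$ and $H^{N-1}$-almost all of $\partial\Omega$ lies in it. 2. At $H^{N-1}$-a.e. $x\in\partial\Omega$ there is exactly one vector $\nu_2(x)$ which is the chart normal at $x$ in some chart whose function is differentiable at the corresponding point; and $\nu_1=\nu_2$ $H^{N-1}$-a.e. on $\partial\Omega$. Moreover, for every chart, $H^{N-1}$-a.e. on $\partial\Omega\cap U$ the function $\varphi$ is differentiable at $x'$ and $\nu_1(x)$ equals the normal given by that chart. 3. For $H^{N-1}$-a.e. $x\in\partial\Omega$ the blow-up of $\Omega$ at $x$ is the half-space of inner normal $\nu_1(x)$: $r^{-N}\,\bigl|(\Omega\,\triangle\,\{y:(y-x)\cdot\nu_1(x)>0\})\cap B_r(x)\bigr|\to0$ as $r\downarrow0$. 4. $\nu_1,\nu_2\in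 L^\infty(\partial\Omega,H^{N-1})$ and, for all $u\in C^1_c(\mathbb R^N,\mathbb R^N)$, $$\int_\Omega\operatorname{div}u\,dx=-\int_{\partial\Omega}u\cdot\nu_1\,dH^{N-1}=-\int_{\partial\Omega}u\cdot\nu_2\,dH^{N-1}.$$ **(B)** Let $N\ge2$ (in particular $N=2$), let $\Omega\subset\mathbb R^N$ be open with $H^{N-1}(\partial\Omega)<\infty$, and let $S$ be a finite set such that $\Omega$ is Lipschitz at every point of $\partial\Omega\setminus S$. Then at $H^{N-1}$-a.e. $x\in\partial\Omega$ the chart normal $\nu_2(x)$ exists and is unique in the sense of (A)2, $\nu_2\in L^\infty(\partial\Omega,H^{N-1})$, and for all $u\in C^1_c(\mathbb R^N,\mathbb R^N)$ $$\int_\Omega\operatorname{div}u\,dx=-\int_{\partial\Omega}u\cdot\nu_2\,dH^{N-1}.$$ -/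

import Mathlib

open MeasureTheory Set Filter Topology
open scoped RealInnerProductSpace symmDiff

/-- `ℝⁿ` with its Euclidean norm. -/
abbrev Euc (n : ℕ) : Type := EuclideanSpace ℝ (Fin n)

/-- Surface measure `H^d` on the topological boundary of `Ω ⊆ ℝ^{d+1}`; `μHE[d]` is the
`d`-dimensional Hausdorff measure with the usual normalisation (it is Lebesgue measure on `ℝ^d`). -/
noncomputable def boundaryMeasure {d : ℕ} (Ω : Set (Euc (d + 1))) : Measure (Euc (d + 1)) :=
  (μHE[d] : Measure (Euc (d + 1))).restrict (frontier Ω)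

/-- The divergence `∑ᵢ ∂ᵢ uᵢ`. -/
noncomputable def divergence {n : ℕ} (u : Euc n → Euc n) (x : Euc n) : ℝ :=
  ∑ i : Fin n, (fderiv ℝ u x (EuclideanSpace.single i 1)) i

/-! ### The measure-theoretic normal (De Giorgi) -/

/-- `D` is the distributional gradient `Dχ_Ω` of the indicator function of `Ω`:
a finite `ℝⁿ`-valued Borel measure with `∫_Ω div u = - ∫ u · dD` for all `u ∈ C¹_c(ℝⁿ, ℝⁿ)`. -/
def IsIndicatorGradient {n : ℕ} (Ω : Set (Euc n)) (D : VectorMeasure (Euc n) (Euc n)) : Prop :=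
  ∀ u : Euc n → Euc n, ContDiff ℝ 1 u → HasCompactSupport u →
    ∫ x in Ω, divergence u x = - ∫ᵛ x, u x ∂[innerSL ℝ; D]

/-- The ratio `D(B_r(x)) / |D|(B_r(x))`, where `|D|` is the total variation measure of `D`. -/
noncomputable def ballRatio {n : ℕ} (D : VectorMeasure (Euc n) (Euc n)) (x : Euc n) (r : ℝ) :
    Euc n :=
  (D.variation.real (Metric.ball x r))⁻¹ • D (Metric.ball x r)

/-- The reduced boundary of a set whose indicator has gradient `D`: the points `x` of the support
of `|D|` at which `D(B_r(x)) / |D|(B_r(x))` converges, as `r ↓ 0`, to a unit vector. -/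
def reducedBoundary {n : ℕ} (D : VectorMeasure (Euc n) (Euc n)) : Set (Euc n) :=
  {x | x ∈ D.variation.support ∧
    ∃ v : Euc n, ‖v‖ = 1 ∧ Tendsto (ballRatio D x) (𝓝[>] 0) (𝓝 v)}

/-- The measure-theoretic inner normal `ν₁(x) = lim_{r ↓ 0} D(B_r(x)) / |D|(B_r(x))`
(meaningful at the points of the reduced boundary). -/
noncomputable def deGiorgiNormal {n : ℕ} (D : VectorMeasure (Euc n) (Euc n)) (x : Euc n) : Euc n :=
  limUnder (𝓝[>] (0 : ℝ)) (ballRatio D x)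

/-! ### Lipschitz open sets and the explicit chart normal (Nečas) -/

/-- Data of a Lipschitz graph chart in `ℝ^{d+1}`: orthonormal coordinates
`R x = (x', t) ∈ ℝ^d × ℝ`, a Lipschitz function `φ` of `x'`, and an open set `U`. -/
structure LipschitzChart (d : ℕ) where
  R : Euc (d + 1) ≃ₗᵢ[ℝ] WithLp 2 (Euc d × ℝ)
  φ : Euc d → ℝ
  lipschitz : ∃ K : NNReal, LipschitzWith K φ
  U : Set (Euc (d + 1))
  isOpen_U : IsOpen U

namespace LipschitzChart

/-- The chart describes `Ω`: inside `U`, the set `Ω` is the strict epigraph of `φ`. -/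
def IsChartOf {d : ℕ} (c : LipschitzChart d) (Ω : Set (Euc (d + 1))) : Prop :=
  ∀ x ∈ c.U, x ∈ Ω ↔ c.φ (c.R x).fst < (c.R x).snd

/-- The explicit inner unit normal `(-∇φ(x'), 1) / √(1 + |∇φ(x')|²)`, written back in the
original coordinates (meaningful where `φ` is differentiable at `x'`). -/
noncomputable def normal {d : ℕ} (c : LipschitzChart d) (x : Euc (d + 1)) : Euc (d + 1) :=
  (Real.sqrt (1 + ‖gradient c.φ (c.R x).fst‖ ^ 2))⁻¹ •
    c.R.symm (WithLp.toLp 2 (-gradient c.φ (c.R x).fst, 1))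

end LipschitzChart

/-- Near `x`, the set `Ω` is, in suitable orthonormal coordinates, the strict epigraph of a
Lipschitz function. -/
def IsLipschitzAt {d : ℕ} (Ω : Set (Euc (d + 1))) (x : Euc (d + 1)) : Prop :=
  ∃ c : LipschitzChart d, c.IsChartOf Ω ∧ x ∈ c.U

/-- `Ω` is a Lipschitz open set. -/
def IsLipschitzOpen {d : ℕ} (Ω : Set (Euc (d + 1))) : Prop :=
  IsOpen Ω ∧ ∀ x ∈ frontier Ω, IsLipschitzAt Ω x

/-- `v` is the explicit inner normal of `Ω` at the boundary point `x`, computed in some chart whose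
function is differentiable at the point below `x`. -/
def IsNecasNormal {d : ℕ} (Ω : Set (Euc (d + 1))) (x v : Euc (d + 1)) : Prop :=
  x ∈ frontier Ω ∧ ∃ c : LipschitzChart d, c.IsChartOf Ω ∧ x ∈ c.U ∧
    DifferentiableAt ℝ c.φ (c.R x).fst ∧ v = c.normal x

open Classical in
/-- The explicit chart inner normal `ν₂` of `Ω`, with value `0` at the points where no chart
gives one. -/
noncomputable def necasNormal {d : ℕ} (Ω : Set (Euc (d + 1))) (x : Euc (d + 1)) : Euc (d + 1) :=
  if h : ∃ v, IsNecasNormal Ω x v then h.choose else 0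

/-- The integration by parts (Stokes) formula on `Ω` with inner normal field `ν`: `ν` is essentially
bounded on `∂Ω` (in particular measurable) and
`∫_Ω div u dx = - ∫_{∂Ω} u · ν dH^d` for all `u ∈ C¹_c(ℝ^{d+1}, ℝ^{d+1})`. -/
def StokesFormula {d : ℕ} (Ω : Set (Euc (d + 1))) (ν : Euc (d + 1) → Euc (d + 1)) : Prop :=
  MemLp ν ⊤ (boundaryMeasure Ω) ∧
    ∀ u : Euc (d + 1) → Euc (d + 1), ContDiff ℝ 1 u → HasCompactSupport u →
      ∫ x in Ω, divergence u x = - ∫ x, ⟪u x, ν x⟫ ∂(boundaryMeasure Ω)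

/-!
On a Lipschitz graph the area formula turns `H^d` into `√(1 + |∇φ|²) dy`, and the product of this
density with the chart normal is `(-∇φ, 1)`. Shearing the epigraph to a half-space, the fundamental
theorem of calculus in the vertical direction, the vanishing of integrals of horizontal derivatives
and Rademacher's theorem give the divergence theorem for fields supported in one chart; a partition
of unity extends it to fields supported away from the closed set `K` of boundary points at which
`Ω` is not Lipschitz. Since `K` is `H^d`-null, it has covers by balls with `∑ rᵢ^d` arbitrarily
small; cutoffs adapted to such covers have gradients small in `L¹`, so `K` can be removed.

Hence `ν₂ H^d⌊∂Ω` is the gradient of the indicator function, and its variation is `H^d⌊∂Ω` because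
`|ν₂| = 1`. Besicovitch differentiation then gives `ν₁ = ν₂` almost everywhere. The chart normal
does not depend on the chart because it is determined by the rays that enter `Ω` and those that
leave it, and by dominated convergence the same description of the rays gives the blow-up.
-/

/-! ### The area formula -/

section AreaFormula

open scoped ENNReal NNReal
open Module (finrank)

theorem euclideanHausdorffMeasure_image_le_of_edist_le {α X Y : Type*} [EMetricSpace X]
    [MeasurableSpace X] [BorelSpace X] [EMetricSpace Y] [MeasurableSpace Y] [BorelSpace Y]
    (n : ℕ) {f : α → X} {g : α → Y} {K : ℝ≥0} {s : Set α}
    (h : ∀ x ∈ s, ∀ y ∈ s, edist (f x) (f y) ≤ K * edist (g x) (g y)) :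
    μHE[n] (f '' s) ≤ (K : ℝ≥0∞) ^ n * μHE[n] (g '' s) := by
  rcases s.eq_empty_or_nonempty with rfl | ⟨x₀, -⟩
  · simp
  have : Nonempty α := ⟨x₀⟩
  -- `f` factors on `s` through `g` and a `K`-Lipschitz map defined on `g '' s`.
  set gInv := Function.invFunOn g s
  have gInv_mem : ∀ y ∈ g '' s, gInv y ∈ s := fun y hy => Function.invFunOn_mem hy
  have g_gInv : ∀ y ∈ g '' s, g (gInv y) = y := fun y hy => Function.invFunOn_eq hy
  have hLip : LipschitzOnWith K (f ∘ gInv) (g '' s) := fun y hy z hz => by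
    simpa only [Function.comp_apply, g_gInv y hy, g_gInv z hz]
      using h _ (gInv_mem y hy) _ (gInv_mem z hz)
  have hfactor : f '' s = (f ∘ gInv) '' (g '' s) := by
    rw [image_image]
    refine image_congr fun x hx => ?_
    have hgx := mem_image_of_mem g hx
    have hzero := h x hx _ (gInv_mem _ hgx)
    rw [g_gInv _ hgx, edist_self, mul_zero] at hzero
    exact edist_le_zero.1 hzero
  have hmeas := hLip.hausdorffMeasure_image_le (d := (n : ℝ)) (by positivity)
  rw [← hfactor, ENNReal.rpow_natCast] at hmeas
  rw [Measure.euclideanHausdorffMeasure_def, Measure.euclideanHausdorffMeasure_def]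
  simp only [Measure.smul_apply, Measure.nnreal_smul_coe_apply]
  rw [mul_left_comm]
  gcongr

theorem euclideanHausdorffMeasure_image_le_of_norm_sub_le {α E F : Type*} [NormedAddCommGroup E]
    [MeasurableSpace E] [BorelSpace E] [NormedAddCommGroup F] [MeasurableSpace F] [BorelSpace F]
    (n : ℕ) {f : α → E} {g : α → F} {K : ℝ≥0} {s : Set α}
    (h : ∀ x ∈ s, ∀ y ∈ s, ‖f x - f y‖ ≤ K * ‖g x - g y‖) :
    μHE[n] (f '' s) ≤ (K : ℝ≥0∞) ^ n * μHE[n] (g '' s) := by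
  refine euclideanHausdorffMeasure_image_le_of_edist_le n fun x hx y hy => ?_
  rw [edist_nndist, edist_nndist]
  have := h x hx y hy
  rw [← dist_eq_norm, ← dist_eq_norm] at this
  exact_mod_cast this

theorem approximatesLinearOn_of_norm_sub_le {E F : Type*} [NormedAddCommGroup E]
    [NormedSpace ℝ E] [NormedAddCommGroup F] [NormedSpace ℝ F] {f : E → F} {A M : E →L[ℝ] F}
    {s : Set E} {c c' : ℝ≥0} (hf : ApproximatesLinearOn f A s c) (h : ‖A - M‖ ≤ c') :
    ApproximatesLinearOn f M s (c + c') := fun x hx y hy =>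
  calc ‖f x - f y - M (x - y)‖ = ‖(f x - f y - A (x - y)) + (A - M) (x - y)‖ := by simp
    _ ≤ c * ‖x - y‖ + c' * ‖x - y‖ :=
      norm_add_le_of_le (hf x hx y hy) (ContinuousLinearMap.le_of_opNorm_le _ h _)
    _ = (c + c' : ℝ≥0) * ‖x - y‖ := by rw [← add_mul, NNReal.coe_add]

theorem le_of_forall_one_lt_le_pow_mul {a b : ℝ≥0∞} (n : ℕ)
    (h : ∀ C : ℝ≥0, 1 < C → a ≤ (C : ℝ≥0∞) ^ n * b) : a ≤ b := by
  have hpow : Tendsto (fun C : ℝ≥0 => (C : ℝ≥0∞) ^ n) (𝓝[>] 1) (𝓝 1) := by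
    have hcont : Continuous (fun C : ℝ≥0 => ((C ^ n : ℝ≥0) : ℝ≥0∞)) := by fun_prop
    simpa using (hcont.tendsto 1).mono_left nhdsWithin_le_nhds
  have hlim : Tendsto (fun C : ℝ≥0 => (C : ℝ≥0∞) ^ n * b) (𝓝[>] 1) (𝓝 b) := by
    simpa using ENNReal.Tendsto.mul_const hpow (b := b) (Or.inl one_ne_zero)
  exact ge_of_tendsto hlim (eventually_nhdsWithin_of_forall h)

variable {E F G : Type*}
  [NormedAddCommGroup E] [InnerProductSpace ℝ E] [FiniteDimensional ℝ E]
  [NormedAddCommGroup F] [InnerProductSpace ℝ F] [NormedAddCommGroup G] [InnerProductSpace ℝ G]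

theorem normDet_le_of_forall_norm_le {L : E →ₗ[ℝ] F} {M : E →ₗ[ℝ] G} {C : ℝ≥0}
    (h : ∀ v, ‖L v‖ ≤ C * ‖M v‖) : L.normDet ≤ C ^ finrank ℝ E * M.normDet := by
  borelize E F G
  set B : Set E := Metric.ball 0 1
  have hB_pos : volume B ≠ 0 := (Metric.measure_ball_pos _ _ one_pos).ne'
  have hB_fin : volume B ≠ ∞ := measure_ball_lt_top.ne
  have hLM := euclideanHausdorffMeasure_image_le_of_norm_sub_le (finrank ℝ E) (f := L) (g := M)
    (s := B) fun x _ y _ => by simpa only [← map_sub] using h (x - y)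
  rw [L.euclideanHausdorffMeasure_image_eq_normDet_mul_volume,
    M.euclideanHausdorffMeasure_image_eq_normDet_mul_volume, ← mul_assoc,
    ENNReal.mul_le_mul_iff_left hB_pos hB_fin, ← ENNReal.ofReal_coe_nnreal,
    ← ENNReal.ofReal_pow C.coe_nonneg, ← ENNReal.ofReal_mul (by positivity)] at hLM
  exact (ENNReal.ofReal_le_ofReal_iff (mul_nonneg (by positivity) M.normDet_nonneg)).1 hLM

theorem exists_pos_forall_norm_sub_le_imp_norm_le {M : E →L[ℝ] F}
    (hM : Function.Injective M) {C : ℝ≥0} (hC : 1 < C) :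
    ∃ r > (0 : ℝ≥0), ∀ v w, ‖w - M v‖ ≤ r * ‖v‖ → ‖w‖ ≤ C * ‖M v‖ ∧ ‖M v‖ ≤ C * ‖w‖ := by
  obtain ⟨K, hK, hMK⟩ := M.toLinearMap.exists_antilipschitzWith (LinearMap.ker_eq_bot.2 hM)
  obtain ⟨δ, rfl⟩ := exists_add_of_le hC.le
  have hδ : 0 < δ := by simpa using hC
  refine ⟨δ / ((1 + δ) * K), by positivity, fun v w hw => ?_⟩
  have hv : ‖v‖ ≤ K * ‖M v‖ := by simpa using hMK.le_mul_norm_sub v 0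
  have hw' : (1 + δ) * ‖w - M v‖ ≤ δ * ‖M v‖ := by
    calc (1 + δ) * ‖w - M v‖ ≤ (1 + δ) * (δ / ((1 + δ) * K) * (K * ‖M v‖)) := by
          push_cast at hw
          gcongr
          exact hw.trans (by gcongr)
      _ = δ * ‖M v‖ := by field_simp
  have h₁ : ‖w‖ ≤ ‖M v‖ + ‖w - M v‖ := norm_le_norm_add_norm_sub' w (M v)
  have h₂ : ‖M v‖ ≤ ‖w‖ + ‖w - M v‖ := norm_le_norm_add_norm_sub w (M v)
  have h₃ : 0 ≤ δ * ‖w - M v‖ := by positivity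
  push_cast
  constructor <;> nlinarith

variable [MeasurableSpace E] [BorelSpace E]

theorem exists_partition_approximatesLinearOn_fderiv [CompleteSpace F] [SecondCountableTopology F]
    {f : E → F} {s : Set E} (hs : s.Nonempty) (hf : ∀ x ∈ s, DifferentiableAt ℝ f x)
    {𝓜 : Set (E →L[ℝ] F)} (h𝓜 : ∀ x ∈ s, fderiv ℝ f x ∈ 𝓜)
    {r : (E →L[ℝ] F) → ℝ≥0} (hr : ∀ M ∈ 𝓜, 0 < r M) :
    ∃ (t : ℕ → Set E) (M : ℕ → E →L[ℝ] F), Pairwise (Function.onFun Disjoint t) ∧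
      (∀ n, MeasurableSet (t n)) ∧ s ⊆ ⋃ n, t n ∧ ∀ n, M n ∈ 𝓜 ∧
        ApproximatesLinearOn f (M n) (s ∩ t n) (r (M n)) ∧
        ∀ x ∈ s ∩ t n, ‖fderiv ℝ f x - M n‖ ≤ r (M n) := by
  borelize F
  obtain ⟨c, hc𝓜, hc, hcover⟩ := TopologicalSpace.countable_cover_nhdsWithin
    (f := fun M => Metric.ball M (r M / 2 : ℝ≥0)) (s := 𝓜) fun M hM =>
      mem_nhdsWithin_of_mem_nhds (Metric.ball_mem_nhds M (half_pos (hr M hM)))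
  have hcover_s : ∀ x ∈ s, ∃ M ∈ c, fderiv ℝ f x ∈ Metric.ball M (r M / 2 : ℝ≥0) :=
    fun x hx => by simpa only [mem_iUnion, exists_prop] using hcover (h𝓜 x hx)
  have hc_nonempty : c.Nonempty := hs.elim fun x hx => (hcover_s x hx).imp fun _ h => h.1
  obtain ⟨M, rfl⟩ := hc.exists_eq_range hc_nonempty
  have hM : ∀ n, M n ∈ 𝓜 := fun n => hc𝓜 (mem_range_self n)
  -- Localize the derivative first, so that the partition below can use a constant precision.
  set S : ℕ → Set E := fun n => fderiv ℝ f ⁻¹' Metric.ball (M n) (r (M n) / 2 : ℝ≥0)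
  have hS : ∀ n, MeasurableSet (S n) := fun n =>
    measurable_fderiv ℝ f Metric.isOpen_ball.measurableSet
  choose t A _ ht_meas ht_cover htA hA using fun n =>
    exists_partition_approximatesLinearOn_of_hasFDerivWithinAt f
      (s ∩ S n) (fderiv ℝ f) (fun x hx => (hf x hx.1).hasFDerivAt.hasFDerivWithinAt)
      (fun _ => r (M n) / 2) fun _ => (half_pos (hr _ (hM n))).ne'
  set U : ℕ → Set E := fun m => S m.unpair.1 ∩ t m.unpair.1 m.unpair.2
  refine ⟨disjointed U, fun m => M m.unpair.1, disjoint_disjointed U,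
    MeasurableSet.disjointed fun m => (hS _).inter (ht_meas _ _), fun x hx => ?_,
    fun m => ⟨hM _, fun x hx y hy => ?_, fun x hx => ?_⟩⟩
  · rw [iUnion_disjointed]
    obtain ⟨_, ⟨n, rfl⟩, hxn⟩ := hcover_s x hx
    obtain ⟨k, hk⟩ := mem_iUnion.1 (ht_cover n ⟨hx, hxn⟩)
    exact mem_iUnion.2 ⟨Nat.pair n k, by simpa only [U, Nat.unpair_pair] using ⟨hxn, hk⟩⟩
  · obtain ⟨z, hz, hAz⟩ := hA m.unpair.1 ⟨x, hx.1, (disjointed_subset U m hx.2).1⟩ m.unpair.2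
    have hAM : ‖A m.unpair.1 m.unpair.2 - M m.unpair.1‖ ≤ (r (M m.unpair.1) / 2 : ℝ≥0) := by
      rw [hAz]
      exact (mem_ball_iff_norm.1 hz.2).le
    have happrox := approximatesLinearOn_of_norm_sub_le (htA m.unpair.1 m.unpair.2) hAM
    rw [add_halves] at happrox
    have hsub : s ∩ disjointed U m ⊆ s ∩ S m.unpair.1 ∩ t m.unpair.1 m.unpair.2 := by
      rw [inter_assoc]
      exact inter_subset_inter_right s (disjointed_subset U m)
    exact happrox x (hsub hx) y (hsub hy)
  · refine (mem_ball_iff_norm.1 (disjointed_subset U m hx.2).1).le.trans ?_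
    exact_mod_cast half_le_self (zero_le (a := r (M m.unpair.1)))

variable [MeasurableSpace F] [BorelSpace F]

theorem euclideanHausdorffMeasure_image_le_lintegral_of_norm_le {f : E → F} {f' : E → E →L[ℝ] F}
    {M : E →L[ℝ] F} {s : Set E} (hs : MeasurableSet s) {C : ℝ≥0}
    (hf : ∀ x ∈ s, ∀ y ∈ s, ‖f x - f y‖ ≤ C * ‖M (x - y)‖)
    (hf' : ∀ x ∈ s, ∀ v, ‖M v‖ ≤ C * ‖f' x v‖) :
    μHE[finrank ℝ E] (f '' s) ≤
      (C : ℝ≥0∞) ^ (2 * finrank ℝ E) * ∫⁻ x in s, ENNReal.ofReal (f' x).toLinearMap.normDet :=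
  calc μHE[finrank ℝ E] (f '' s)
      ≤ (C : ℝ≥0∞) ^ finrank ℝ E * μHE[finrank ℝ E] (M '' s) :=
        euclideanHausdorffMeasure_image_le_of_norm_sub_le _ fun x hx y hy => by
          simpa only [map_sub] using hf x hx y hy
    _ = (C : ℝ≥0∞) ^ finrank ℝ E * ∫⁻ _ in s, ENNReal.ofReal M.toLinearMap.normDet := by
        rw [setLIntegral_const]
        exact congrArg _ (M.toLinearMap.euclideanHausdorffMeasure_image_eq_normDet_mul_volume s)
    _ ≤ (C : ℝ≥0∞) ^ finrank ℝ E * ∫⁻ x in s, (C : ℝ≥0∞) ^ finrank ℝ E *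
          ENNReal.ofReal (f' x).toLinearMap.normDet := by
        gcongr _ * ?_
        refine setLIntegral_mono_ae' hs (Eventually.of_forall fun x hx => ?_)
        rw [← ENNReal.ofReal_coe_nnreal, ← ENNReal.ofReal_pow C.coe_nonneg,
          ← ENNReal.ofReal_mul (by positivity)]
        exact ENNReal.ofReal_le_ofReal (normDet_le_of_forall_norm_le (hf' x hx))
    _ = _ := by
        rw [lintegral_const_mul' _ _ (ENNReal.pow_ne_top ENNReal.coe_ne_top), ← mul_assoc,
          ← pow_add, two_mul]

theorem lintegral_le_euclideanHausdorffMeasure_image_of_norm_le {f : E → F} {f' : E → E →L[ℝ] F}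
    {M : E →L[ℝ] F} {s : Set E} (hs : MeasurableSet s) {C : ℝ≥0}
    (hf : ∀ x ∈ s, ∀ y ∈ s, ‖M (x - y)‖ ≤ C * ‖f x - f y‖)
    (hf' : ∀ x ∈ s, ∀ v, ‖f' x v‖ ≤ C * ‖M v‖) :
    ∫⁻ x in s, ENNReal.ofReal (f' x).toLinearMap.normDet ≤
      (C : ℝ≥0∞) ^ (2 * finrank ℝ E) * μHE[finrank ℝ E] (f '' s) :=
  calc ∫⁻ x in s, ENNReal.ofReal (f' x).toLinearMap.normDet
      ≤ ∫⁻ _ in s, (C : ℝ≥0∞) ^ finrank ℝ E * ENNReal.ofReal M.toLinearMap.normDet := by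
        refine setLIntegral_mono_ae' hs (Eventually.of_forall fun x hx => ?_)
        rw [← ENNReal.ofReal_coe_nnreal, ← ENNReal.ofReal_pow C.coe_nonneg,
          ← ENNReal.ofReal_mul (by positivity)]
        exact ENNReal.ofReal_le_ofReal (normDet_le_of_forall_norm_le (hf' x hx))
    _ = (C : ℝ≥0∞) ^ finrank ℝ E * μHE[finrank ℝ E] (M '' s) := by
        rw [setLIntegral_const, mul_assoc]
        exact congrArg _
          (M.toLinearMap.euclideanHausdorffMeasure_image_eq_normDet_mul_volume s).symm
    _ ≤ (C : ℝ≥0∞) ^ finrank ℝ E * ((C : ℝ≥0∞) ^ finrank ℝ E * μHE[finrank ℝ E] (f '' s)) := by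
        gcongr _ * ?_
        exact euclideanHausdorffMeasure_image_le_of_norm_sub_le _ fun x hx y hy => by
          simpa only [map_sub] using hf x hx y hy
    _ = _ := by rw [← mul_assoc, ← pow_add, two_mul]

/-- The area formula is an identity for injective linear maps, and on the pieces of a fine partition
`f` is `C`-bi-Lipschitz equivalent to such a map. -/
theorem exists_partition_area_le [CompleteSpace F] [SecondCountableTopology F] {f : E → F}
    {s : Set E} (hs : MeasurableSet s) (hf : ∀ x ∈ s, DifferentiableAt ℝ f x)
    (hf' : ∀ x ∈ s, Function.Injective (fderiv ℝ f x)) {C : ℝ≥0} (hC : 1 < C) :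
    ∃ t : ℕ → Set E, (∀ n, MeasurableSet (t n)) ∧
      Pairwise (Function.onFun Disjoint t) ∧ s = ⋃ n, t n ∧ ∀ n,
        μHE[finrank ℝ E] (f '' t n) ≤ (C : ℝ≥0∞) ^ (2 * finrank ℝ E) *
          ∫⁻ x in t n, ENNReal.ofReal (fderiv ℝ f x).toLinearMap.normDet ∧
        ∫⁻ x in t n, ENNReal.ofReal (fderiv ℝ f x).toLinearMap.normDet ≤
          (C : ℝ≥0∞) ^ (2 * finrank ℝ E) * μHE[finrank ℝ E] (f '' t n) := by
  rcases s.eq_empty_or_nonempty with rfl | hs_nonempty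
  · exact ⟨fun _ => ∅, by simp, fun _ _ _ => disjoint_bot_left, by simp, by simp⟩
  choose! r hr_pos hr using fun (M : E →L[ℝ] F) (hM : Function.Injective M) =>
    exists_pos_forall_norm_sub_le_imp_norm_le hM hC
  obtain ⟨t, M, ht_disj, ht_meas, ht_cover, htM⟩ :=
    exists_partition_approximatesLinearOn_fderiv hs_nonempty hf
      (𝓜 := {M | Function.Injective M}) hf' hr_pos
  have happrox := fun n x hx y hy => hr (M n) (htM n).1 (x - y) _ ((htM n).2.1 x hx y hy)
  have hderiv := fun n x hx v => hr (M n) (htM n).1 v (fderiv ℝ f x v)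
    (ContinuousLinearMap.le_of_opNorm_le (fderiv ℝ f x - M n) ((htM n).2.2 x hx) v)
  refine ⟨fun n => s ∩ t n, fun n => hs.inter (ht_meas n), fun i j hij =>
    (ht_disj hij).mono inter_subset_right inter_subset_right,
    by rw [← inter_iUnion, inter_eq_left.2 ht_cover], fun n => ⟨?_, ?_⟩⟩
  · exact euclideanHausdorffMeasure_image_le_lintegral_of_norm_le (hs.inter (ht_meas n))
      (fun x hx y hy => (happrox n x hx y hy).1) fun x hx v => (hderiv n x hx v).2
  · exact lintegral_le_euclideanHausdorffMeasure_image_of_norm_le (hs.inter (ht_meas n))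
      (fun x hx y hy => (happrox n x hx y hy).2) fun x hx v => (hderiv n x hx v).1

theorem euclideanHausdorffMeasure_image_eq_lintegral_normDet [CompleteSpace F]
    [SecondCountableTopology F] {f : E → F} {s : Set E} (hs : MeasurableSet s)
    (hf : ∀ x ∈ s, DifferentiableAt ℝ f x) (hf' : ∀ x ∈ s, Function.Injective (fderiv ℝ f x))
    (hinj : InjOn f s) :
    μHE[finrank ℝ E] (f '' s) =
      ∫⁻ x in s, ENNReal.ofReal (fderiv ℝ f x).toLinearMap.normDet := by
  refine le_antisymm (le_of_forall_one_lt_le_pow_mul (2 * finrank ℝ E) fun C hC => ?_)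
    (le_of_forall_one_lt_le_pow_mul (2 * finrank ℝ E) fun C hC => ?_)
  · obtain ⟨t, ht_meas, ht_disj, rfl, ht⟩ := exists_partition_area_le hs hf hf' hC
    rw [image_iUnion, lintegral_iUnion ht_meas ht_disj, ← ENNReal.tsum_mul_left]
    exact (measure_iUnion_le _).trans (ENNReal.tsum_le_tsum fun n => (ht n).1)
  · obtain ⟨t, ht_meas, ht_disj, rfl, ht⟩ := exists_partition_area_le hs hf hf' hC
    have ht_sub := subset_iUnion t
    have himage_meas : ∀ n, MeasurableSet (f '' t n) := fun n =>
      (ht_meas n).image_of_continuousOn_injOn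
        (fun x hx => (hf x (ht_sub n hx)).continuousAt.continuousWithinAt) (hinj.mono (ht_sub n))
    have himage_disj : Pairwise (Function.onFun Disjoint fun n => f '' t n) := fun i j hij =>
      disjoint_image_image
        fun x hx y hy hxy => disjoint_left.1 (ht_disj hij) hx
          (hinj (ht_sub i hx) (ht_sub j hy) hxy ▸ hy)
    rw [image_iUnion, lintegral_iUnion ht_meas ht_disj, measure_iUnion himage_disj himage_meas,
      ← ENNReal.tsum_mul_left]
    exact ENNReal.tsum_le_tsum fun n => (ht n).2

theorem euclideanHausdorffMeasure_image_eq_zero_of_lipschitzWith {X : Type*} [EMetricSpace X]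
    [MeasurableSpace X] [BorelSpace X] {f : E → X} {K : ℝ≥0} (hf : LipschitzWith K f) {s : Set E}
    (hs : volume s = 0) : μHE[finrank ℝ E] (f '' s) = 0 := by
  have h := euclideanHausdorffMeasure_image_le_of_edist_le (finrank ℝ E) (f := f) (g := id)
    (K := K) (s := s) fun x _ y _ => hf x y
  rw [image_id, InnerProductSpace.euclideanHausdorffMeasure_eq_volume, hs, mul_zero] at h
  exact le_antisymm h zero_le

theorem map_withDensity_normDet_fderiv [FiniteDimensional ℝ F] {f : E → F} {K : ℝ≥0}
    (hf : LipschitzWith K f) (hinj : Function.Injective f)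
    (hf' : ∀ᵐ x, Function.Injective (fderiv ℝ f x)) :
    (volume.withDensity fun x => ENNReal.ofReal (fderiv ℝ f x).toLinearMap.normDet).map f =
      (μHE[finrank ℝ E] : Measure F).restrict (range f) := by
  have hemb : MeasurableEmbedding f := hf.continuous.measurableEmbedding hinj
  obtain ⟨D, hD_ae, hD_meas, hD⟩ :=
    ((hf.ae_differentiableAt (μ := volume)).and hf').exists_measurable_mem
  ext B hB
  have hB' : MeasurableSet (f ⁻¹' B) := hemb.measurable hB
  have hnull : volume (f ⁻¹' B \ D) = 0 := measure_mono_null (fun x hx => hx.2) hD_ae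
  have harea : μHE[finrank ℝ E] (f '' (f ⁻¹' B ∩ D)) =
      ∫⁻ x in f ⁻¹' B ∩ D, ENNReal.ofReal (fderiv ℝ f x).toLinearMap.normDet :=
    euclideanHausdorffMeasure_image_eq_lintegral_normDet (hB'.inter hD_meas)
      (fun x hx => (hD x hx.2).1) (fun x hx => (hD x hx.2).2) hinj.injOn
  rw [Measure.map_apply hemb.measurable hB, Measure.restrict_apply hB,
    ← image_preimage_eq_inter_range, withDensity_apply _ hB',
    ← measure_inter_add_sdiff (f '' (f ⁻¹' B)) (hemb.measurableSet_image.2 hD_meas),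
    ← image_inter hinj, ← image_sdiff hinj,
    euclideanHausdorffMeasure_image_eq_zero_of_lipschitzWith hf hnull, add_zero, harea]
  refine setLIntegral_congr (ae_eq_set.2 ⟨by rwa [sdiff_self_inter], ?_⟩)
  rw [sdiff_eq_empty.2 inter_subset_left, measure_empty]

end AreaFormula

/-! ### Graphs of Lipschitz functions -/

section Graph

/-- The graph parametrization `y ↦ (y, φ y)`, with values in the `L²` product so that Hausdorff
measures are the Euclidean ones. -/
noncomputable def graphMap {E : Type*} (φ : E → ℝ) (y : E) :
    WithLp 2 (E × ℝ) := WithLp.toLp 2 (y, φ y)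

theorem graphMap_injective {E : Type*} (φ : E → ℝ) : Function.Injective (graphMap φ) :=
  fun _ _ h => congrArg WithLp.fst h

variable {E : Type*} [NormedAddCommGroup E] [InnerProductSpace ℝ E]

/-- The differential `v ↦ (v, L v)` of a graph parametrization. -/
noncomputable def linearGraph (L : E →L[ℝ] ℝ) : E →L[ℝ] WithLp 2 (E × ℝ) :=
  (WithLp.prodContinuousLinearEquiv 2 ℝ E ℝ).symm.toContinuousLinearMap ∘L
    (ContinuousLinearMap.id ℝ E).prod L

theorem linearGraph_injective (L : E →L[ℝ] ℝ) : Function.Injective (linearGraph L) :=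
  graphMap_injective L

theorem hasFDerivAt_graphMap {φ : E → ℝ} {L : E →L[ℝ] ℝ} {y : E} (h : HasFDerivAt φ L y) :
    HasFDerivAt (graphMap φ) (linearGraph L) y :=
  (WithLp.prodContinuousLinearEquiv 2 ℝ E ℝ).symm.hasFDerivAt.comp y ((hasFDerivAt_id y).prodMk h)

theorem lipschitzWith_graphMap {φ : E → ℝ} {K : NNReal} (h : LipschitzWith K φ) :
    ∃ K', LipschitzWith K' (graphMap φ) :=
  ⟨_, ((WithLp.prodContinuousLinearEquiv 2 ℝ E ℝ).symm.lipschitz).comp (LipschitzWith.id.prodMk h)⟩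

theorem normDet_linearGraph [FiniteDimensional ℝ E] (L : E →L[ℝ] ℝ) :
    (linearGraph L).toLinearMap.normDet = Real.sqrt (1 + ‖L‖ ^ 2) := by
  obtain ⟨w, rfl⟩ := (InnerProductSpace.toDual ℝ E).surjective L
  set b := stdOrthonormalBasis ℝ E
  set c : Fin (Module.finrank ℝ E) → ℝ := fun i => ⟪w, b i⟫
  have hgram : Matrix.gram ℝ (fun i => linearGraph (InnerProductSpace.toDual ℝ E w) (b i)) =
      1 + Matrix.replicateCol Unit c * Matrix.replicateRow Unit c := by
    ext i j
    have hij := orthonormal_iff_ite.1 b.orthonormal i j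
    simp [Matrix.gram, linearGraph, WithLp.prod_inner_apply, Matrix.mul_apply, Matrix.one_apply,
      hij, c, mul_comm]
  have hsq : (linearGraph (InnerProductSpace.toDual ℝ E w)).toLinearMap.normDet ^ 2 =
      1 + ‖w‖ ^ 2 := by
    have hdet := (linearGraph (InnerProductSpace.toDual ℝ E w)).toLinearMap.normDet_sq_eq_det_gram b
    have hnorm := b.sum_sq_norm_inner_left w
    simp only [ContinuousLinearMap.coe_coe, hgram, Matrix.det_one_add_replicateCol_mul_replicateRow,
      RCLike.ofReal_real_eq_id, id] at hdet
    rw [hdet, ← hnorm]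
    simp [dotProduct, c, pow_two]
  rw [LinearIsometryEquiv.norm_map, ← hsq, Real.sqrt_sq (LinearMap.normDet_nonneg _)]

theorem map_graphMap_withDensity [FiniteDimensional ℝ E] [MeasurableSpace E] [BorelSpace E]
    {φ : E → ℝ} {K : NNReal} (hφ : LipschitzWith K φ) :
    (volume.withDensity fun y => ENNReal.ofReal √(1 + ‖fderiv ℝ φ y‖ ^ 2)).map (graphMap φ) =
      (μHE[Module.finrank ℝ E] : Measure (WithLp 2 (E × ℝ))).restrict (range (graphMap φ)) := by
  obtain ⟨K', hK'⟩ := lipschitzWith_graphMap hφ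
  have hderiv : ∀ᵐ y, fderiv ℝ (graphMap φ) y = linearGraph (fderiv ℝ φ y) :=
    hφ.ae_differentiableAt.mono fun y hy => (hasFDerivAt_graphMap hy.hasFDerivAt).fderiv
  rw [← map_withDensity_normDet_fderiv hK' (graphMap_injective φ)
    (hderiv.mono fun y hy => hy ▸ linearGraph_injective _)]
  congr 1
  refine withDensity_congr_ae (hderiv.mono fun y hy => ?_)
  simp only [hy, normDet_linearGraph]

end Graph

/-! ### Integration by parts on the epigraph of a Lipschitz function -/

theorem integral_lineDeriv_eq_zero {E : Type*} [NormedAddCommGroup E] [NormedSpace ℝ E]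
    [MeasurableSpace E] [BorelSpace E] [FiniteDimensional ℝ E] {μ : Measure E}
    [μ.IsAddHaarMeasure] {K : NNReal} {g : E → ℝ} (hg : LipschitzWith K g)
    (hgc : HasCompactSupport g) (v : E) : ∫ x, lineDeriv ℝ g x v ∂μ = 0 := by
  have hparts := LipschitzWith.integral_lineDeriv_mul_eq (μ := μ) (f := fun _ : E => (1 : ℝ))
    (C := 0) (LipschitzWith.const _) hg hgc (-v)
  have hconst : ∀ x, lineDeriv ℝ (fun _ : E => (1 : ℝ)) x (-v) = 0 := fun x => by
    simp [lineDeriv]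
  simpa [hconst] using hparts.symm

theorem integral_Ioi_fderiv_vertical {E : Type*} [NormedAddCommGroup E] [NormedSpace ℝ E]
    {F : E × ℝ → ℝ} {φ : E → ℝ} (hF : ContDiff ℝ 1 F) (hFc : HasCompactSupport F) (y : E) :
    ∫ s in Ioi (0 : ℝ), fderiv ℝ F (y, φ y + s) (0, 1) = -F (y, φ y) := by
  set f : ℝ → ℝ := fun s => F (y, φ y + s)
  have hcd : ContDiff ℝ 1 f := hF.comp (by fun_prop)
  have hcs : HasCompactSupport f := by
    refine HasCompactSupport.intro
      (hFc.isCompact.image (f := fun z : E × ℝ => z.2 - φ y) (by fun_prop)) fun s hs => ?_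
    by_contra h
    exact hs ⟨_, subset_tsupport _ h, by simp⟩
  have hd : ∀ s, deriv f s = fderiv ℝ F (y, φ y + s) (0, 1) := by
    intro s
    have hline : HasDerivAt (fun s : ℝ => (y, φ y + s)) ((0 : E), (1 : ℝ)) s :=
      (hasDerivAt_const s y).prodMk ((hasDerivAt_id s).const_add (φ y))
    exact (((hF.differentiable one_ne_zero) _).hasFDerivAt.comp_hasDerivAt s hline).deriv
  simp_rw [← hd]
  rw [hcs.integral_Ioi_deriv_eq hcd 0]
  simp [f]

section Epigraph

variable {E : Type*} [NormedAddCommGroup E] [InnerProductSpace ℝ E] [MeasurableSpace E]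
  [BorelSpace E] [FiniteDimensional ℝ E] {F : E × ℝ → ℝ} {φ : E → ℝ} {K : NNReal}

theorem measurePreserving_shear (hφ : Continuous φ) :
    MeasurePreserving (fun z : E × ℝ => (z.1, φ z.1 + z.2)) volume volume := by
  refine MeasurePreserving.skew_product (f := id) (g := fun x t => φ x + t)
    (MeasurePreserving.id volume) (by fun_prop) (Eventually.of_forall fun x => ?_)
  exact (measurePreserving_add_left volume (φ x)).map_eq

theorem measurableEmbedding_shear (hφ : Continuous φ) :
    MeasurableEmbedding (fun z : E × ℝ => (z.1, φ z.1 + z.2)) := by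
  refine Continuous.measurableEmbedding (by fun_prop) ?_
  rintro ⟨x, s⟩ ⟨y, t⟩ h
  simp only [Prod.mk.injEq] at h
  obtain ⟨rfl, h⟩ := h
  simpa using h

theorem integrable_sheared_deriv (hF : ContDiff ℝ 1 F) (hFc : HasCompactSupport F)
    (hφ : LipschitzWith K φ) (v : E) :
    Integrable (fun z : E × ℝ => fderiv ℝ F (z.1, φ z.1 + z.2) (v, fderiv ℝ φ z.1 v)) := by
  have hcont : Continuous (fun z : E × ℝ => fderiv ℝ F (z.1, φ z.1 + z.2)) :=
    (hF.continuous_fderiv one_ne_zero).comp (by have := hφ.continuous; fun_prop)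
  have hnorm : Integrable (fun z : E × ℝ => ‖fderiv ℝ F z‖) :=
    ((hF.continuous_fderiv one_ne_zero).integrable_of_hasCompactSupport (hFc.fderiv ℝ)).norm
  have hbound :
      Integrable (fun z : E × ℝ => ‖fderiv ℝ F (z.1, φ z.1 + z.2)‖ * max ‖v‖ (K * ‖v‖)) :=
    ((measurePreserving_shear hφ.continuous).integrable_comp_of_integrable hnorm).mul_const _
  refine hbound.mono' ?_ (Eventually.of_forall fun z => ?_)
  · have hm : Measurable fun z : E × ℝ => (v, fderiv ℝ φ z.1 v) :=
      measurable_const.prodMk (((measurable_fderiv_apply_const ℝ φ v)).comp measurable_fst)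
    exact isBoundedBilinearMap_apply.continuous.comp_aestronglyMeasurable
      (hcont.aestronglyMeasurable.prodMk hm.aestronglyMeasurable)
  · refine (ContinuousLinearMap.le_opNorm _ _).trans ?_
    gcongr
    rw [Prod.norm_def]
    refine max_le_max le_rfl ((ContinuousLinearMap.le_opNorm _ _).trans ?_)
    gcongr
    exact norm_fderiv_le_of_lipschitz ℝ hφ

theorem integral_sheared_deriv_eq_zero (hF : ContDiff ℝ 1 F) (hFc : HasCompactSupport F)
    (hφ : LipschitzWith K φ) (v : E) (s : ℝ) :
    ∫ y, fderiv ℝ F (y, φ y + s) (v, fderiv ℝ φ y v) = 0 := by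
  set w : E → ℝ := fun y => F (y, φ y + s)
  obtain ⟨C, hC⟩ := hF.lipschitzWith_of_hasCompactSupport hFc one_ne_zero
  have hwl : LipschitzWith (C * max 1 K) w := by
    refine hC.comp (LipschitzWith.prodMk LipschitzWith.id ?_)
    refine LipschitzWith.of_dist_le_mul fun x y => ?_
    rw [dist_add_right]
    exact hφ.dist_le_mul x y
  have hwc : HasCompactSupport w := by
    refine HasCompactSupport.intro (hFc.isCompact.image continuous_fst) fun y hy => ?_
    by_contra h
    exact hy ⟨_, subset_tsupport _ h, rfl⟩
  rw [← integral_lineDeriv_eq_zero (μ := volume) hwl hwc v]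
  refine integral_congr_ae ?_
  filter_upwards [hφ.ae_differentiableAt (μ := volume)] with y hy
  have hgraph : HasFDerivAt (fun y => (y, φ y + s))
      ((ContinuousLinearMap.id ℝ E).prod (fderiv ℝ φ y)) y :=
    (hasFDerivAt_id y).prodMk (hy.hasFDerivAt.add_const s)
  have hw := ((hF.differentiable one_ne_zero) (y, φ y + s)).hasFDerivAt.comp y hgraph
  exact (hw.hasLineDerivAt v).lineDeriv.symm

theorem setIntegral_epigraph_eq_integral_shear (hφ : Continuous φ) (G : E × ℝ → ℝ) :
    ∫ z in {z : E × ℝ | φ z.1 < z.2}, G z =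
      ∫ z, G (z.1, φ z.1 + z.2) ∂(volume.prod (volume.restrict (Ioi 0))) := by
  have hpreimage : (fun z : E × ℝ => (z.1, φ z.1 + z.2)) ⁻¹' {z : E × ℝ | φ z.1 < z.2} =
      univ ×ˢ Ioi (0 : ℝ) := by
    ext z
    simp
  rw [← (measurePreserving_shear hφ).setIntegral_preimage_emb (measurableEmbedding_shear hφ),
    hpreimage, Measure.volume_eq_prod, ← Measure.prod_restrict, Measure.restrict_univ]

/-- After the shear `(y, s) ↦ (y, φ y + s)` the epigraph is the half-space `s > 0`. The tangential
direction `(v, φ' v)` contributes nothing, and what remains of `(v, c)` is vertical. -/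
theorem setIntegral_fderiv_epigraph (hF : ContDiff ℝ 1 F) (hFc : HasCompactSupport F)
    (hφ : LipschitzWith K φ) (v : E) (c : ℝ) :
    ∫ z in {z : E × ℝ | φ z.1 < z.2}, fderiv ℝ F z (v, c) =
      ∫ y, (fderiv ℝ φ y v - c) * F (y, φ y) := by
  set half : Measure (E × ℝ) := volume.prod (volume.restrict (Ioi 0))
  have hhalf : half ≤ volume := Measure.prod_mono le_rfl Measure.restrict_le_self
  have hint : Integrable (fun z : E × ℝ => fderiv ℝ F (z.1, φ z.1 + z.2) (v, c)) half :=
    ((measurePreserving_shear hφ.continuous).integrable_comp_of_integrable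
      (((hF.continuous_fderiv one_ne_zero).clm_apply
        continuous_const).integrable_of_hasCompactSupport
          (hFc.fderiv_apply ℝ (v, c)))).mono_measure hhalf
  have hint_tangent : Integrable
      (fun z : E × ℝ => fderiv ℝ F (z.1, φ z.1 + z.2) (v, fderiv ℝ φ z.1 v)) half :=
    (integrable_sheared_deriv hF hFc hφ v).mono_measure hhalf
  have htangent : ∫ z, fderiv ℝ F (z.1, φ z.1 + z.2) (v, fderiv ℝ φ z.1 v) ∂half = 0 := by
    rw [integral_prod_symm _ hint_tangent]
    simp only [integral_sheared_deriv_eq_zero hF hFc hφ v, integral_zero]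
  have hvertical : ∀ y s,
      fderiv ℝ F (y, φ y + s) (v, c) - fderiv ℝ F (y, φ y + s) (v, fderiv ℝ φ y v) =
        (c - fderiv ℝ φ y v) * fderiv ℝ F (y, φ y + s) (0, 1) := fun y s => by
    rw [← map_sub, ← smul_eq_mul, ← map_smul]
    simp
  calc ∫ z in {z : E × ℝ | φ z.1 < z.2}, fderiv ℝ F z (v, c)
      = ∫ z, (fderiv ℝ F (z.1, φ z.1 + z.2) (v, c) -
          fderiv ℝ F (z.1, φ z.1 + z.2) (v, fderiv ℝ φ z.1 v)) ∂half := by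
        rw [setIntegral_epigraph_eq_integral_shear hφ.continuous,
          integral_sub hint hint_tangent, htangent, sub_zero]
    _ = ∫ y, ∫ s in Ioi (0 : ℝ), (c - fderiv ℝ φ y v) * fderiv ℝ F (y, φ y + s) (0, 1) := by
        simp only [← hvertical]
        exact integral_prod _ (hint.sub hint_tangent)
    _ = ∫ y, (fderiv ℝ φ y v - c) * F (y, φ y) := by
        refine integral_congr_ae (Eventually.of_forall fun y => ?_)
        simp only [integral_const_mul, integral_Ioi_fderiv_vertical hF hFc]
        ring

end Epigraph

/-! ### The divergence -/

section Divergence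

theorem integral_fderiv_apply_eq_zero {E : Type*} [NormedAddCommGroup E] [NormedSpace ℝ E]
    [MeasurableSpace E] [BorelSpace E] [FiniteDimensional ℝ E] {μ : Measure E}
    [μ.IsAddHaarMeasure] {f : E → ℝ} (hf : ContDiff ℝ 1 f) (hfc : HasCompactSupport f) (v : E) :
    ∫ x, fderiv ℝ f x v ∂μ = 0 := by
  obtain ⟨C, hC⟩ := hf.lipschitzWith_of_hasCompactSupport hfc one_ne_zero
  rw [← integral_lineDeriv_eq_zero (μ := μ) hC hfc v]
  exact integral_congr_ae <| Eventually.of_forall fun x =>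
    (hf.differentiable one_ne_zero x).lineDeriv_eq_fderiv.symm

variable {n : ℕ} {u : Euc n → Euc n} {x : Euc n}

theorem divergence_eq_sum (hu : Differentiable ℝ u) (x : Euc n) :
    divergence u x = ∑ i, fderiv ℝ (fun y => u y i) x (EuclideanSpace.single i 1) := by
  refine Finset.sum_congr rfl fun i _ => ?_
  have hcoord : fderiv ℝ (fun y => u y i) x = _ :=
    ((EuclideanSpace.proj i : Euc n →L[ℝ] ℝ).hasFDerivAt.comp x (hu x).hasFDerivAt).fderiv
  rw [hcoord]
  rfl

theorem divergence_eq_zero_of_notMem_tsupport (hx : x ∉ tsupport u) : divergence u x = 0 := by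
  have hfderiv : fderiv ℝ u x = 0 :=
    Function.notMem_support.1 fun h => hx (support_fderiv_subset ℝ h)
  simp [divergence, hfderiv]

theorem integrable_divergence (hu : ContDiff ℝ 1 u) (huc : HasCompactSupport u) :
    Integrable (divergence u) := by
  refine Continuous.integrable_of_hasCompactSupport ?_ ?_
  · have := hu.continuous_fderiv one_ne_zero
    unfold divergence
    fun_prop
  · exact HasCompactSupport.intro huc fun x hx => divergence_eq_zero_of_notMem_tsupport hx

theorem divergence_sum {ι : Type*} (s : Finset ι) {u : ι → Euc n → Euc n}
    (hu : ∀ i ∈ s, Differentiable ℝ (u i)) (x : Euc n) :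
    divergence (fun x => ∑ i ∈ s, u i x) x = ∑ i ∈ s, divergence (u i) x := by
  simp only [divergence, fderiv_fun_sum fun i hi => hu i hi x]
  rw [Finset.sum_comm]
  simp

theorem divergence_smul {f : Euc n → ℝ} (hf : DifferentiableAt ℝ f x)
    (hu : DifferentiableAt ℝ u x) :
    divergence (fun y => f y • u y) x = f x * divergence u x + fderiv ℝ f x (u x) := by
  have hexpand : u x = ∑ i, u x i • EuclideanSpace.single i (1 : ℝ) := by
    simpa using ((EuclideanSpace.basisFun (Fin n) ℝ).sum_repr (u x)).symm
  conv_rhs => rw [hexpand]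
  simp only [divergence, fderiv_fun_smul hf hu, map_sum, map_smul, smul_eq_mul, Finset.mul_sum,
    ← Finset.sum_add_distrib, add_apply, smul_apply, PiLp.add_apply, PiLp.smul_apply,
    ContinuousLinearMap.smulRight_apply]
  exact Finset.sum_congr rfl fun i _ => by ring

theorem setIntegral_divergence_eq_sum (hu : ContDiff ℝ 1 u) (huc : HasCompactSupport u)
    (s : Set (Euc n)) :
    ∫ x in s, divergence u x =
      ∑ i, ∫ x in s, fderiv ℝ (fun y => u y i) x (EuclideanSpace.single i 1) := by
  simp_rw [divergence_eq_sum (hu.differentiable one_ne_zero)]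
  refine integral_finsetSum _ fun i _ => Integrable.integrableOn ?_
  have hui : ContDiff ℝ 1 fun y => u y i := by fun_prop
  have huci : HasCompactSupport fun y => u y i :=
    huc.comp_left (g := fun z : Euc n => z i) rfl
  exact ((hui.continuous_fderiv one_ne_zero).clm_apply
    continuous_const).integrable_of_hasCompactSupport (huci.fderiv_apply ℝ _)

theorem integral_divergence_eq_zero (hu : ContDiff ℝ 1 u) (huc : HasCompactSupport u) :
    ∫ x, divergence u x = 0 := by
  rw [← setIntegral_univ, setIntegral_divergence_eq_sum hu huc]
  refine Finset.sum_eq_zero fun i _ => ?_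
  rw [setIntegral_univ]
  exact integral_fderiv_apply_eq_zero (by fun_prop)
    (huc.comp_left (g := fun z : Euc n => z i) rfl) _

theorem indicator_eventuallyEq_of_tsupport_subset_compl_frontier {X M : Type*}
    [TopologicalSpace X] [Zero M] {s : Set X} {f : X → M}
    (hf : tsupport f ⊆ (frontier s)ᶜ) (x : X) :
    x ∈ s ∧ s.indicator f =ᶠ[𝓝 x] f ∨ (x ∉ s ∨ f =ᶠ[𝓝 x] 0) ∧ s.indicator f =ᶠ[𝓝 x] 0 := by
  by_cases hx : x ∈ tsupport f
  · by_cases hint : x ∈ interior s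
    · refine .inl ⟨interior_subset hint, ?_⟩
      filter_upwards [isOpen_interior.mem_nhds hint] with y hy
      exact indicator_of_mem (interior_subset hy) f
    · have hclosure : x ∉ closure s := fun h => hf hx ⟨h, hint⟩
      refine .inr ⟨.inl fun h => hclosure (subset_closure h), ?_⟩
      filter_upwards [isClosed_closure.isOpen_compl.mem_nhds hclosure] with y hy
      exact indicator_of_notMem (fun h => hy (subset_closure h)) f
  · have hzero := notMem_tsupport_iff_eventuallyEq.1 hx
    exact .inr ⟨.inr hzero, hzero.mono fun y hy => by simp [hy]⟩

/-- Cutting off `u` along the boundary of `Ω` keeps it `C¹`, because `u` vanishes there. -/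
theorem setIntegral_divergence_eq_zero {Ω : Set (Euc n)} (hΩ : MeasurableSet Ω)
    (hu : ContDiff ℝ 1 u) (huc : HasCompactSupport u) (hsupp : tsupport u ⊆ (frontier Ω)ᶜ) :
    ∫ x in Ω, divergence u x = 0 := by
  have hloc := indicator_eventuallyEq_of_tsupport_subset_compl_frontier hsupp
  have hcut : ContDiff ℝ 1 (Ω.indicator u) := contDiff_iff_contDiffAt.2 fun x => by
    rcases hloc x with ⟨-, h⟩ | ⟨-, h⟩
    · exact hu.contDiffAt.congr_of_eventuallyEq h
    · exact contDiffAt_const.congr_of_eventuallyEq h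
  have hcutc : HasCompactSupport (Ω.indicator u) := huc.mono (by
    rw [support_indicator]; exact inter_subset_right)
  rw [← integral_indicator hΩ, ← integral_divergence_eq_zero hcut hcutc]
  congr 1
  ext x
  rcases hloc x with ⟨hx, h⟩ | ⟨hx | hx, h⟩
  · rw [indicator_of_mem hx, divergence, divergence, h.fderiv_eq]
  · rw [indicator_of_notMem hx, divergence, h.fderiv_eq]
    simp
  · simp [divergence, h.fderiv_eq, hx.fderiv_eq]

end Divergence

/-! ### Lipschitz charts -/

theorem setIntegral_eq_of_mem_iff_of_ne_zero {α E : Type*} [MeasurableSpace α]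
    [NormedAddCommGroup E] [NormedSpace ℝ E] {μ : Measure α} {s t : Set α} {f : α → E}
    (hs : MeasurableSet s) (ht : MeasurableSet t) (h : ∀ x, f x ≠ 0 → (x ∈ s ↔ x ∈ t)) :
    ∫ x in s, f x ∂μ = ∫ x in t, f x ∂μ := by
  classical
  rw [← integral_indicator hs, ← integral_indicator ht]
  congr 1
  ext x
  by_cases hx : f x = 0
  · simp [indicator_apply, hx]
  · simp only [indicator_apply, h x hx]

theorem measurable_gradient {E : Type*} [NormedAddCommGroup E] [InnerProductSpace ℝ E]
    [CompleteSpace E] [MeasurableSpace E] [BorelSpace E] (f : E → ℝ) :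
    Measurable (gradient f) :=
  (InnerProductSpace.toDual ℝ E).symm.continuous.measurable.comp (measurable_fderiv ℝ f)

namespace LipschitzChart

variable {d : ℕ} (c : LipschitzChart d)

/-- The parametrization `y ↦ (y, φ y)` of the graph of a chart, in the original coordinates. -/
noncomputable def param (y : Euc d) : Euc (d + 1) := c.R.symm (graphMap c.φ y)

/-- The strict epigraph of the chart function, in the original coordinates. -/
def epigraph : Set (Euc (d + 1)) := {x | c.φ (c.R x).fst < (c.R x).snd}

/-- The upward conormal `(-∇φ(y), 1)` of the graph, in the original coordinates. Its norm is the
area density of the graph. -/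
noncomputable def conormal (y : Euc d) : Euc (d + 1) :=
  c.R.symm (WithLp.toLp 2 (-gradient c.φ y, 1))

theorem continuous_φ : Continuous c.φ := c.lipschitz.choose_spec.continuous

theorem R_param (y : Euc d) : c.R (c.param y) = graphMap c.φ y := c.R.apply_symm_apply _

theorem R_param_fst (y : Euc d) : (c.R (c.param y)).fst = y := by rw [R_param]; rfl

theorem mem_range_param {x : Euc (d + 1)} :
    x ∈ range c.param ↔ c.φ (c.R x).fst = (c.R x).snd := by
  constructor
  · rintro ⟨y, rfl⟩
    rw [R_param]; rfl
  · intro h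
    refine ⟨(c.R x).fst, ?_⟩
    rw [param, LinearIsometryEquiv.symm_apply_eq]
    exact WithLp.ofLp_injective 2 (Prod.ext rfl h)

theorem continuous_graphMap_φ : Continuous (graphMap c.φ) :=
  let ⟨_, hK⟩ := c.lipschitz
  let ⟨_, hK'⟩ := lipschitzWith_graphMap hK
  hK'.continuous

theorem continuous_param : Continuous c.param :=
  c.R.symm.continuous.comp c.continuous_graphMap_φ

theorem measurableEmbedding_param : MeasurableEmbedding c.param :=
  c.continuous_param.measurableEmbedding (c.R.symm.injective.comp (graphMap_injective _))

theorem isOpen_epigraph : IsOpen c.epigraph := by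
  have := c.continuous_φ
  exact isOpen_lt (by fun_prop) (by fun_prop)

theorem frontier_epigraph : frontier c.epigraph = range c.param := by
  have hφ := c.continuous_φ
  refine Subset.antisymm (fun x hx => c.mem_range_param.2 ?_) fun x hx => ?_
  · exact frontier_lt_subset_eq (by fun_prop) (by fun_prop) hx
  have hgraph := c.mem_range_param.1 hx
  rw [c.isOpen_epigraph.frontier_eq]
  refine ⟨?_, fun h : c.φ _ < _ => h.ne hgraph⟩
  set up : Euc (d + 1) := c.R.symm (WithLp.toLp 2 (0, 1))
  have hlim : Tendsto (fun s : ℝ => x + s • up) (𝓝[>] 0) (𝓝 x) := by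
    have hcont : Continuous fun s : ℝ => x + s • up := by fun_prop
    simpa using (hcont.tendsto 0).mono_left (nhdsWithin_le_nhds (s := Ioi 0))
  refine mem_closure_of_tendsto hlim ?_
  filter_upwards [self_mem_nhdsWithin] with s (hs : 0 < s)
  simp [epigraph, up, hgraph, hs]

theorem ae_differentiableAt_φ : ∀ᵐ y, DifferentiableAt ℝ c.φ y :=
  let ⟨_, hK⟩ := c.lipschitz
  hK.ae_differentiableAt

theorem norm_conormal (y : Euc d) : ‖c.conormal y‖ = √(1 + ‖gradient c.φ y‖ ^ 2) := by
  rw [conormal, LinearIsometryEquiv.norm_map, WithLp.prod_norm_eq_of_L2]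
  simp [add_comm]

theorem conormal_ne_zero (y : Euc d) : c.conormal y ≠ 0 := by
  rw [← norm_pos_iff, norm_conormal]
  positivity

theorem normal_eq_normalize (x : Euc (d + 1)) :
    c.normal x = NormedSpace.normalize (c.conormal (c.R x).fst) := by
  rw [normal, ← norm_conormal]
  rfl

theorem norm_normal (x : Euc (d + 1)) : ‖c.normal x‖ = 1 := by
  rw [normal_eq_normalize, NormedSpace.norm_normalize (c.conormal_ne_zero _)]

theorem norm_conormal_smul_normal (y : Euc d) :
    ‖c.conormal y‖ • c.normal (c.param y) = c.conormal y := by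
  rw [normal_eq_normalize, R_param_fst, NormedSpace.norm_smul_normalize]

theorem inner_conormal (y : Euc d) (v : Euc (d + 1)) :
    ⟪c.conormal y, v⟫ = (c.R v).snd - fderiv ℝ c.φ y (c.R v).fst := by
  rw [conormal, ← LinearIsometryEquiv.inner_map_map c.R, LinearIsometryEquiv.apply_symm_apply,
    WithLp.prod_inner_apply, ← inner_gradient_left]
  simp only [inner_neg_left, RCLike.inner_apply, map_one, mul_one]
  exact neg_add_eq_sub _ _

theorem measurable_conormal : Measurable c.conormal :=
  c.R.symm.continuous.measurable.comp <| (WithLp.measurable_toLp 2 _).comp <|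
    (measurable_gradient c.φ).neg.prodMk measurable_const

theorem measurable_normal : Measurable c.normal := by
  have hfst : Measurable fun x => (c.R x).fst :=
    (by fun_prop : Continuous fun x => (c.R x).fst).measurable
  have hconormal := c.measurable_conormal.comp hfst
  rw [funext c.normal_eq_normalize]
  exact hconormal.norm.inv.smul hconormal

theorem norm_conormal_le {K : NNReal} (hK : LipschitzWith K c.φ) (y : Euc d) :
    ‖c.conormal y‖ ≤ √(1 + K ^ 2) := by
  rw [norm_conormal, ← LinearIsometryEquiv.norm_map (InnerProductSpace.toDual ℝ (Euc d)),
    toDual_gradient]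
  gcongr
  exact norm_fderiv_le_of_lipschitz ℝ hK

theorem map_param_withDensity :
    (volume.withDensity fun y => ENNReal.ofReal ‖c.conormal y‖).map c.param =
      (μHE[d] : Measure (Euc (d + 1))).restrict (range c.param) := by
  obtain ⟨K, hK⟩ := c.lipschitz
  have hR : MeasurePreserving c.R.symm (μHE[d]) (μHE[d]) :=
    c.R.symm.toIsometryEquiv.measurePreserving_euclideanHausdorffMeasure d
  have hgraph := map_graphMap_withDensity hK
  simp only [finrank_euclideanSpace_fin, ← toDual_gradient, LinearIsometryEquiv.norm_map,
    ← norm_conormal] at hgraph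
  rw [show c.param = c.R.symm ∘ graphMap c.φ from rfl, ← Measure.map_map
    c.R.symm.continuous.measurable c.continuous_graphMap_φ.measurable, hgraph, range_comp]
  exact (hR.restrict_image_emb c.R.symm.toHomeomorph.measurableEmbedding _).map_eq

theorem integral_inner_normal (u : Euc (d + 1) → Euc (d + 1)) :
    ∫ x in range c.param, ⟪u x, c.normal x⟫ ∂μHE[d] = ∫ y, ⟪u (c.param y), c.conormal y⟫ := by
  rw [← map_param_withDensity, c.measurableEmbedding_param.integral_map,
    integral_withDensity_eq_integral_toReal_smul c.measurable_conormal.norm.ennreal_ofReal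
      (by simp)]
  refine integral_congr_ae (Eventually.of_forall fun y => ?_)
  simp only [ENNReal.toReal_ofReal (norm_nonneg _), smul_eq_mul, ← real_inner_smul_right,
    norm_conormal_smul_normal]

theorem setIntegral_fderiv_epigraph {f : Euc (d + 1) → ℝ} (hf : ContDiff ℝ 1 f)
    (hfc : HasCompactSupport f) (v : Euc (d + 1)) :
    ∫ x in c.epigraph, fderiv ℝ f x v = -∫ y, ⟪c.conormal y, v⟫ * f (c.param y) := by
  obtain ⟨K, hK⟩ := c.lipschitz
  set T : (Euc d × ℝ) ≃L[ℝ] Euc (d + 1) :=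
    (WithLp.prodContinuousLinearEquiv 2 ℝ (Euc d) ℝ).symm.trans
      c.R.symm.toContinuousLinearEquiv
  have hRT : ∀ z, c.R (T z) = WithLp.toLp 2 z := fun z => c.R.apply_symm_apply _
  have hT : MeasurePreserving T volume volume :=
    c.R.symm.measurePreserving.comp (WithLp.volume_preserving_toLp _ _)
  have hpreimage : T ⁻¹' c.epigraph = {z | c.φ z.1 < z.2} := by
    ext z
    simp only [epigraph, mem_preimage, mem_ofPred_eq, hRT]
    rfl
  have hfderiv : ∀ z, fderiv ℝ f (T z) v = fderiv ℝ (f ∘ T) z ((c.R v).fst, (c.R v).snd) := by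
    intro z
    rw [ContinuousLinearEquiv.comp_right_fderiv, ContinuousLinearMap.comp_apply]
    exact congrArg _ (c.R.symm_apply_apply v).symm
  rw [← hT.setIntegral_preimage_emb T.toHomeomorph.measurableEmbedding, hpreimage]
  simp_rw [hfderiv]
  rw [_root_.setIntegral_fderiv_epigraph (hf.comp T.contDiff) (hfc.comp_homeomorph T.toHomeomorph)
    hK, ← integral_neg]
  simp_rw [inner_conormal, ← neg_mul, neg_sub]
  rfl

theorem hasCompactSupport_comp_param {f : Euc (d + 1) → ℝ} (hfc : HasCompactSupport f) :
    HasCompactSupport (f ∘ c.param) := by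
  refine HasCompactSupport.intro
    (hfc.isCompact.image (f := fun x => (c.R x).fst) (by fun_prop)) fun y hy => ?_
  by_contra h
  exact hy ⟨_, subset_tsupport _ h, c.R_param_fst y⟩

theorem integrable_inner_conormal_mul {f : Euc (d + 1) → ℝ} (hf : Continuous f)
    (hfc : HasCompactSupport f) (v : Euc (d + 1)) :
    Integrable fun y => ⟪c.conormal y, v⟫ * f (c.param y) := by
  obtain ⟨K, hK⟩ := c.lipschitz
  have hint : Integrable (f ∘ c.param) :=
    (hf.comp c.continuous_param).integrable_of_hasCompactSupport
      (c.hasCompactSupport_comp_param hfc)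
  refine hint.bdd_mul (c := √(1 + K ^ 2) * ‖v‖)
    c.measurable_conormal.inner_const.aestronglyMeasurable (Eventually.of_forall fun y => ?_)
  exact (norm_inner_le_norm _ _).trans (by gcongr; exact c.norm_conormal_le hK y)

theorem setIntegral_divergence_epigraph {u : Euc (d + 1) → Euc (d + 1)} (hu : ContDiff ℝ 1 u)
    (huc : HasCompactSupport u) :
    ∫ x in c.epigraph, divergence u x =
      -∫ x in range c.param, ⟪u x, c.normal x⟫ ∂μHE[d] := by
  have hui : ∀ i, ContDiff ℝ 1 fun x => u x i := fun i => by fun_prop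
  have huci : ∀ i, HasCompactSupport fun x => u x i := fun i =>
    huc.comp_left (g := fun z : Euc (d + 1) => z i) rfl
  rw [setIntegral_divergence_eq_sum hu huc, integral_inner_normal]
  simp_rw [fun i => c.setIntegral_fderiv_epigraph (hui i) (huci i) (EuclideanSpace.single i 1)]
  rw [Finset.sum_neg_distrib, ← integral_finsetSum _
    fun i _ => c.integrable_inner_conormal_mul (hui i).continuous (huci i) _]
  simp [PiLp.inner_apply]

variable {c} {Ω : Set (Euc (d + 1))}

theorem mem_frontier_iff (hc : c.IsChartOf Ω) {x : Euc (d + 1)} (hx : x ∈ c.U) :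
    x ∈ frontier Ω ↔ x ∈ range c.param := by
  have hinter : Ω ∩ c.U = c.epigraph ∩ c.U :=
    Set.ext fun y => and_congr_left fun hy => hc y hy
  have hfrontier : frontier Ω ∩ c.U = range c.param ∩ c.U := by
    rw [← frontier_epigraph, ← frontier_inter_open_inter c.isOpen_U, hinter,
      frontier_inter_open_inter c.isOpen_U]
  simpa [hx] using Set.ext_iff.1 hfrontier x

theorem ae_differentiableAt (hc : c.IsChartOf Ω) :
    ∀ᵐ x ∂boundaryMeasure Ω, x ∈ c.U → DifferentiableAt ℝ c.φ (c.R x).fst := by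
  have hgraph : ∀ᵐ x ∂(μHE[d] : Measure (Euc (d + 1))).restrict (range c.param),
      DifferentiableAt ℝ c.φ (c.R x).fst := by
    rw [← map_param_withDensity, c.measurableEmbedding_param.ae_map_iff]
    simp only [R_param_fst]
    exact (withDensity_absolutelyContinuous _ _).ae_le c.ae_differentiableAt_φ
  rw [ae_restrict_iff' c.measurableEmbedding_param.measurableSet_range] at hgraph
  rw [boundaryMeasure, ae_restrict_iff' isClosed_frontier.measurableSet]
  filter_upwards [hgraph] with x hx hxf hxU
  exact hx ((mem_frontier_iff hc hxU).1 hxf)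

theorem setIntegral_divergence_of_tsupport_subset (hΩ : MeasurableSet Ω) (hc : c.IsChartOf Ω)
    {u : Euc (d + 1) → Euc (d + 1)} (hu : ContDiff ℝ 1 u) (huc : HasCompactSupport u)
    (hsupp : tsupport u ⊆ c.U) :
    ∫ x in Ω, divergence u x = -∫ x, ⟪u x, c.normal x⟫ ∂boundaryMeasure Ω := by
  rw [setIntegral_eq_of_mem_iff_of_ne_zero hΩ c.isOpen_epigraph.measurableSet fun x hx =>
      hc x (hsupp (not_imp_comm.1 divergence_eq_zero_of_notMem_tsupport hx)),
    c.setIntegral_divergence_epigraph hu huc, boundaryMeasure,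
    setIntegral_eq_of_mem_iff_of_ne_zero isClosed_frontier.measurableSet
      c.measurableEmbedding_param.measurableSet_range fun x hx => mem_frontier_iff hc (hsupp ?_)]
  refine subset_tsupport u fun hux => hx ?_
  rw [hux, inner_zero_left]

end LipschitzChart

/-! ### Ray normals and blow-ups -/

section RayNormal

variable {E : Type*} [NormedAddCommGroup E] [InnerProductSpace ℝ E] {Ω : Set E} {x ν ν' : E}

/-- Every ray from `x` entering the open half-space of inner normal `ν` starts inside `Ω`, and
every opposite ray starts outside. This weak notion of inner normal does not refer to charts, so it
compares the normals of different charts. -/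
def IsRayNormal (Ω : Set E) (x ν : E) : Prop :=
  ∀ v, (0 < ⟪ν, v⟫ → ∀ᶠ s in 𝓝[>] (0 : ℝ), x + s • v ∈ Ω) ∧
    (⟪ν, v⟫ < 0 → ∀ᶠ s in 𝓝[>] (0 : ℝ), x + s • v ∉ Ω)

theorem IsRayNormal.unique (h : IsRayNormal Ω x ν) (h' : IsRayNormal Ω x ν') (hν : ‖ν‖ = 1)
    (hν' : ‖ν'‖ = 1) : ν = ν' := by
  by_contra hne
  have hlt : ⟪ν, ν'⟫ < 1 := (inner_lt_one_iff_real_of_norm_eq_one hν hν').2 hne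
  have hpos : 0 < ⟪ν, ν - ν'⟫ := by
    rw [inner_sub_right, real_inner_self_eq_norm_sq, hν]; linarith
  have hneg : ⟪ν', ν - ν'⟫ < 0 := by
    rw [inner_sub_right, real_inner_self_eq_norm_sq, hν', real_inner_comm]; linarith
  obtain ⟨s, hs, hs'⟩ := (((h (ν - ν')).1 hpos).and ((h' (ν - ν')).2 hneg)).exists
  exact hs' hs

theorem IsRayNormal.eventually_notMem_symmDiff (h : IsRayNormal Ω x ν) {z : E}
    (hz : ⟪ν, z⟫ ≠ 0) : ∀ᶠ s in 𝓝[>] (0 : ℝ), x + s • z ∉ Ω ∆ {y | 0 < ⟪y - x, ν⟫} := by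
  have hinner : ∀ s : ℝ, ⟪x + s • z - x, ν⟫ = s * ⟪ν, z⟫ := fun s => by
    rw [add_sub_cancel_left, real_inner_smul_left, real_inner_comm]
  rcases hz.lt_or_gt with hneg | hpos
  · filter_upwards [(h z).2 hneg, self_mem_nhdsWithin] with s hs (hs0 : 0 < s)
    have := mul_neg_of_pos_of_neg hs0 hneg
    simp only [mem_symmDiff, mem_ofPred_eq, hs, hinner, this.not_gt, false_and, or_self,
      not_false_eq_true]
  · filter_upwards [(h z).1 hpos, self_mem_nhdsWithin] with s hs (hs0 : 0 < s)
    have := mul_pos hs0 hpos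
    simp only [mem_symmDiff, mem_ofPred_eq, hs, hinner, this, not_true_eq_false, and_false,
      or_self, not_false_eq_true]

variable [MeasurableSpace E] [BorelSpace E] [FiniteDimensional ℝ E]

theorem ae_inner_ne_zero {μ : Measure E} [μ.IsAddHaarMeasure] (hν : ν ≠ 0) :
    ∀ᵐ z ∂μ, ⟪ν, z⟫ ≠ 0 := by
  have hker : LinearMap.ker (innerSL ℝ ν).toLinearMap ≠ ⊤ := fun htop =>
    hν (inner_self_eq_zero.1 (LinearMap.mem_ker.1 (htop ▸ Submodule.mem_top : ν ∈ _)))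
  exact measure_mono_null (fun z hz => not_not.1 hz) (Measure.addHaar_submodule μ _ hker)

theorem measureReal_inter_ball_div_pow {μ : Measure E} [μ.IsAddHaarMeasure] {A : Set E}
    (hA : MeasurableSet A) (x : E) {r : ℝ} (hr : 0 < r) :
    μ.real (A ∩ Metric.ball x r) / r ^ Module.finrank ℝ E =
      ∫ z in Metric.ball 0 1, A.indicator 1 (x + r • z) ∂μ := by
  have hball : ∀ z : E, x + r • z ∈ Metric.ball x r ↔ z ∈ Metric.ball (0 : E) 1 := fun z => by
    rw [mem_ball_iff_norm, mem_ball_zero_iff, add_sub_cancel_left, norm_smul,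
      Real.norm_of_nonneg hr.le, mul_lt_iff_lt_one_right hr]
  have hindicator : ∀ z : E,
      (Metric.ball 0 1).indicator (fun z => A.indicator 1 (x + r • z)) z =
        (A ∩ Metric.ball x r).indicator (1 : E → ℝ) (x + r • z) := fun z => by
    classical
    by_cases hz : z ∈ Metric.ball (0 : E) 1
    · rw [indicator_of_mem hz]
      simp only [indicator_apply, mem_inter_iff, hball, hz, and_true]
    · rw [indicator_of_notMem hz, indicator_of_notMem fun h => hz ((hball z).1 h.2)]
  rw [← integral_indicator Metric.isOpen_ball.measurableSet]
  simp_rw [hindicator]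
  rw [Measure.integral_comp_smul μ
    (fun z => (A ∩ Metric.ball x r).indicator (1 : E → ℝ) (x + z)) r, integral_add_left_eq_self,
    integral_indicator_one (hA.inter Metric.isOpen_ball.measurableSet), abs_of_pos (by positivity),
    smul_eq_mul, div_eq_inv_mul]

theorem IsRayNormal.tendsto_blowup {μ : Measure E} [μ.IsAddHaarMeasure] (hΩ : MeasurableSet Ω)
    (hν : ν ≠ 0) (h : IsRayNormal Ω x ν) :
    Tendsto (fun r : ℝ => μ.real ((Ω ∆ {y | 0 < ⟪y - x, ν⟫}) ∩ Metric.ball x r) /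
      r ^ Module.finrank ℝ E) (𝓝[>] 0) (𝓝 0) := by
  set A : Set E := Ω ∆ {y | 0 < ⟪y - x, ν⟫}
  have hA : MeasurableSet A :=
    hΩ.symmDiff (isOpen_lt continuous_const (by fun_prop)).measurableSet
  have hlim : Tendsto (fun r : ℝ => ∫ z in Metric.ball 0 1, A.indicator (1 : E → ℝ) (x + r • z) ∂μ)
      (𝓝[>] 0) (𝓝 (∫ _ in Metric.ball (0 : E) 1, (0 : ℝ) ∂μ)) := by
    refine tendsto_integral_filter_of_dominated_convergence 1 ?_ ?_ ?_ ?_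
    · refine Eventually.of_forall fun r => Measurable.aestronglyMeasurable ?_
      exact (measurable_one.indicator hA).comp (by fun_prop)
    · refine Eventually.of_forall fun r => Eventually.of_forall fun z => ?_
      exact norm_indicator_le_norm_self 1 _ |>.trans_eq (by simp)
    · exact integrableOn_const measure_ball_lt_top.ne
    · filter_upwards [ae_restrict_of_ae (ae_inner_ne_zero hν)] with z hz
      refine tendsto_const_nhds.congr' ?_
      filter_upwards [h.eventually_notMem_symmDiff hz] with r hr
      exact (indicator_of_notMem hr _).symm
  rw [integral_zero] at hlim
  refine hlim.congr' ?_
  filter_upwards [self_mem_nhdsWithin] with r hr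
  exact (measureReal_inter_ball_div_pow hA x hr).symm

end RayNormal

/-! ### The chart normal -/

section NecasNormal

variable {d : ℕ} {Ω : Set (Euc (d + 1))} {x ν ν' : Euc (d + 1)} {c : LipschitzChart d}

theorem eventually_pos_of_hasDerivAt {g : ℝ → ℝ} {g' a : ℝ} (hg : HasDerivAt g g' a)
    (hga : g a = 0) (hg' : 0 < g') : ∀ᶠ s in 𝓝[>] a, 0 < g s := by
  have hslope := (hasDerivAt_iff_tendsto_slope.1 hg).mono_left
    (nhdsWithin_mono a (fun s hs => ne_of_gt hs : Ioi a ⊆ {a}ᶜ))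
  filter_upwards [hslope.eventually_const_lt hg', self_mem_nhdsWithin] with s hs (hsa : a < s)
  rw [slope_def_field, hga, sub_zero] at hs
  exact (div_pos_iff_of_pos_right (sub_pos.2 hsa)).1 hs

theorem LipschitzChart.hasDerivAt_height (hd : DifferentiableAt ℝ c.φ (c.R x).fst)
    (v : Euc (d + 1)) :
    HasDerivAt (fun s : ℝ => (c.R (x + s • v)).snd - c.φ (c.R (x + s • v)).fst)
      ⟪c.conormal (c.R x).fst, v⟫ 0 := by
  rw [c.inner_conormal]
  have hsnd : HasDerivAt (fun s : ℝ => (c.R (x + s • v)).snd) (c.R v).snd 0 := by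
    simpa using ((hasDerivAt_id (0 : ℝ)).mul_const (c.R v).snd).const_add (c.R x).snd
  have hfst : HasDerivAt (fun s : ℝ => (c.R (x + s • v)).fst) (c.R v).fst 0 := by
    simpa using ((hasDerivAt_id (0 : ℝ)).smul_const (c.R v).fst).const_add (c.R x).fst
  have hφ : HasFDerivAt c.φ (fderiv ℝ c.φ (c.R x).fst) (c.R (x + (0 : ℝ) • v)).fst := by
    simpa using hd.hasFDerivAt
  exact hsnd.sub (hφ.comp_hasDerivAt (0 : ℝ) hfst)

theorem LipschitzChart.isRayNormal (hc : c.IsChartOf Ω) (hx : x ∈ c.U) (hxf : x ∈ frontier Ω)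
    (hd : DifferentiableAt ℝ c.φ (c.R x).fst) : IsRayNormal Ω x (c.normal x) := by
  intro v
  have hgraph := c.mem_range_param.1 ((mem_frontier_iff hc hx).1 hxf)
  have hscale : 0 < ‖c.conormal (c.R x).fst‖⁻¹ :=
    inv_pos.2 (norm_pos_iff.2 (c.conormal_ne_zero _))
  have hheight := c.hasDerivAt_height hd v
  have hU : ∀ᶠ s in 𝓝[>] (0 : ℝ), x + s • v ∈ c.U := by
    have hray : Continuous fun s : ℝ => x + s • v := by fun_prop
    refine ((hray.tendsto 0).mono_left nhdsWithin_le_nhds).eventually (c.isOpen_U.mem_nhds ?_)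
    simpa using hx
  rw [c.normal_eq_normalize, NormedSpace.normalize, real_inner_smul_left]
  constructor
  · intro hv
    filter_upwards [hU, eventually_pos_of_hasDerivAt hheight (by simp [hgraph])
      ((mul_pos_iff_of_pos_left hscale).1 hv)] with s hsU hs
    exact (hc _ hsU).2 (sub_pos.1 hs)
  · intro hv
    filter_upwards [hU, eventually_pos_of_hasDerivAt hheight.neg (by simp [hgraph])
      (neg_pos.2 (by nlinarith))] with s hsU hs hmem
    have := (hc _ hsU).1 hmem
    simp only [Pi.neg_apply, neg_sub, sub_pos] at hs
    exact hs.not_gt this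

theorem IsNecasNormal.isRayNormal (h : IsNecasNormal Ω x ν) : IsRayNormal Ω x ν := by
  obtain ⟨hxf, c, hc, hx, hd, rfl⟩ := h
  exact c.isRayNormal hc hx hxf hd

theorem IsNecasNormal.norm_eq_one (h : IsNecasNormal Ω x ν) : ‖ν‖ = 1 := by
  obtain ⟨-, c, -, -, -, rfl⟩ := h
  exact c.norm_normal x

theorem IsNecasNormal.unique (h : IsNecasNormal Ω x ν) (h' : IsNecasNormal Ω x ν') : ν = ν' :=
  h.isRayNormal.unique h'.isRayNormal h.norm_eq_one h'.norm_eq_one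

theorem isNecasNormal_necasNormal (h : ∃ v, IsNecasNormal Ω x v) :
    IsNecasNormal Ω x (necasNormal Ω x) := by
  rw [necasNormal, dif_pos h]
  exact h.choose_spec

theorem IsNecasNormal.necasNormal_eq (h : IsNecasNormal Ω x ν) : necasNormal Ω x = ν :=
  (isNecasNormal_necasNormal ⟨ν, h⟩).unique h

theorem LipschitzChart.ae_isNecasNormal (hc : c.IsChartOf Ω) :
    ∀ᵐ x ∂boundaryMeasure Ω, x ∈ c.U →
      DifferentiableAt ℝ c.φ (c.R x).fst ∧ IsNecasNormal Ω x (c.normal x) := by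
  filter_upwards [c.ae_differentiableAt hc, ae_restrict_mem isClosed_frontier.measurableSet]
    with x hx hxf hxU
  exact ⟨hx hxU, hxf, c, hc, hxU, hx hxU, rfl⟩

end NecasNormal

section ChartCover

variable {d : ℕ} {Ω : Set (Euc (d + 1))}

theorem isOpen_setOf_isLipschitzAt : IsOpen {x | IsLipschitzAt Ω x} := by
  refine isOpen_iff_mem_nhds.2 fun x ⟨c, hc, hx⟩ => ?_
  filter_upwards [c.isOpen_U.mem_nhds hx] with y hy using ⟨c, hc, hy⟩

theorem exists_countable_charts (Ω : Set (Euc (d + 1))) :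
    ∃ T : Set (LipschitzChart d), T.Countable ∧ (∀ c ∈ T, c.IsChartOf Ω) ∧
      ∀ x, IsLipschitzAt Ω x → ∃ c ∈ T, x ∈ c.U := by
  obtain ⟨T, hT, hTU⟩ := TopologicalSpace.isOpen_iUnion_countable
    (fun c : {c : LipschitzChart d // c.IsChartOf Ω} => c.1.U) (fun c => c.1.isOpen_U)
  refine ⟨Subtype.val '' T, hT.image _, ?_, fun x ⟨c, hc, hx⟩ => ?_⟩
  · rintro _ ⟨c, -, rfl⟩
    exact c.2
  · have hxU : x ∈ ⋃ c : {c : LipschitzChart d // c.IsChartOf Ω}, c.1.U :=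
      mem_iUnion.2 ⟨⟨c, hc⟩, hx⟩
    rw [← hTU] at hxU
    obtain ⟨c', hc', hx'⟩ := mem_iUnion₂.1 hxU
    exact ⟨c', mem_image_of_mem _ hc', hx'⟩

theorem ae_exists_isNecasNormal (hlip : ∀ᵐ x ∂boundaryMeasure Ω, IsLipschitzAt Ω x) :
    ∀ᵐ x ∂boundaryMeasure Ω, ∃ v, IsNecasNormal Ω x v := by
  obtain ⟨T, hT, hTc, hTU⟩ := exists_countable_charts Ω
  filter_upwards [(ae_ball_iff hT).2 fun c hc => (LipschitzChart.ae_isNecasNormal (hTc c hc)),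
    hlip] with x hx hxL
  obtain ⟨c, hc, hxc⟩ := hTU x hxL
  exact ⟨_, (hx c hc hxc).2⟩

theorem ae_existsUnique_isNecasNormal (hlip : ∀ᵐ x ∂boundaryMeasure Ω, IsLipschitzAt Ω x) :
    ∀ᵐ x ∂boundaryMeasure Ω, ∃! v, IsNecasNormal Ω x v :=
  (ae_exists_isNecasNormal hlip).mono fun _ ⟨v, hv⟩ => ⟨v, hv, fun _ hw => hw.unique hv⟩

theorem ae_norm_necasNormal (hlip : ∀ᵐ x ∂boundaryMeasure Ω, IsLipschitzAt Ω x) :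
    ∀ᵐ x ∂boundaryMeasure Ω, ‖necasNormal Ω x‖ = 1 :=
  (ae_exists_isNecasNormal hlip).mono fun _ hx => (isNecasNormal_necasNormal hx).norm_eq_one

theorem aestronglyMeasurable_necasNormal (hlip : ∀ᵐ x ∂boundaryMeasure Ω, IsLipschitzAt Ω x) :
    AEStronglyMeasurable (necasNormal Ω) (boundaryMeasure Ω) := by
  obtain ⟨T, hT, hTc, hTU⟩ := exists_countable_charts Ω
  have : Countable T := hT.to_subtype
  have hcover : ∀ᵐ x ∂boundaryMeasure Ω, x ∈ ⋃ c : T, c.1.U := hlip.mono fun x hx => by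
    simpa using hTU x hx
  rw [← Measure.restrict_eq_self_of_ae_mem hcover, aestronglyMeasurable_iUnion_iff]
  intro c
  refine c.1.measurable_normal.aestronglyMeasurable.congr ?_
  refine (ae_restrict_iff' c.1.isOpen_U.measurableSet).2 ?_
  filter_upwards [LipschitzChart.ae_isNecasNormal (hTc c c.2)] with x hx hxU
  exact (hx hxU).2.necasNormal_eq.symm

theorem memLp_top_necasNormal (hlip : ∀ᵐ x ∂boundaryMeasure Ω, IsLipschitzAt Ω x) :
    MemLp (necasNormal Ω) ⊤ (boundaryMeasure Ω) :=
  memLp_top_of_bound (aestronglyMeasurable_necasNormal hlip) 1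
    ((ae_norm_necasNormal hlip).mono fun _ hx => hx.le)

end ChartCover

/-! ### Localisation of the divergence formula -/

section DivergenceFormulaOn

variable {n : ℕ} {Ω : Set (Euc n)} {μ : Measure (Euc n)} {ν : Euc n → Euc n}

/-- The formula `∫_Ω div u = -∫ u · ν dμ` for the `C¹_c` vector fields supported in `W`. Taking
`W` smaller than the whole space localises the divergence theorem. -/
def DivergenceFormulaOn (Ω : Set (Euc n)) (μ : Measure (Euc n)) (ν : Euc n → Euc n)
    (W : Set (Euc n)) : Prop :=
  ∀ u : Euc n → Euc n, ContDiff ℝ 1 u → HasCompactSupport u → tsupport u ⊆ W →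
    ∫ x in Ω, divergence u x = -∫ x, ⟪u x, ν x⟫ ∂μ

theorem integrable_inner_of_hasCompactSupport {X E : Type*} [TopologicalSpace X]
    [MeasurableSpace X] [OpensMeasurableSpace X] [NormedAddCommGroup E] [InnerProductSpace ℝ E]
    [SecondCountableTopologyEither X E] {μ : Measure X} {ν u : X → E}
    (hν : Integrable ν μ) (hu : Continuous u) (huc : HasCompactSupport u) :
    Integrable (fun x => ⟪u x, ν x⟫) μ := by
  obtain ⟨M, hM⟩ := hu.bounded_above_of_compact_support huc
  exact (innerSL ℝ).integrable_of_bilin_of_bdd_left M hu.aestronglyMeasurable (ae_of_all _ hM) hν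

open scoped Manifold ContDiff in
theorem exists_contDiff_partition {E : Type*} [NormedAddCommGroup E] [NormedSpace ℝ E]
    [FiniteDimensional ℝ E] {K : Set E} (hK : IsClosed K) {ι : Type*}
    [Fintype ι] {V : ι → Set E} (hV : ∀ i, IsOpen (V i)) (hKV : K ⊆ ⋃ i, V i) :
    ∃ f : ι → E → ℝ, (∀ i, ContDiff ℝ 1 (f i)) ∧ (∀ i, tsupport (f i) ⊆ V i) ∧
      ∀ x ∈ K, ∑ i, f i x = 1 := by
  obtain ⟨f, hf⟩ := SmoothPartitionOfUnity.exists_isSubordinate 𝓘(ℝ, E) hK V hV hKV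
  refine ⟨fun i => f i, fun i => ?_, hf, fun x hx => ?_⟩
  · exact (f i).contMDiff.contDiff.of_le (by exact_mod_cast le_top)
  · rw [← finsum_eq_sum_of_fintype]
    exact f.sum_eq_one hx

theorem DivergenceFormulaOn.setIntegral_divergence_sum {ι : Type*} [Fintype ι]
    {w : ι → Euc n → Euc n} {V : ι → Set (Euc n)} (hν : Integrable ν μ)
    (h : ∀ i, DivergenceFormulaOn Ω μ ν (V i)) (hw : ∀ i, ContDiff ℝ 1 (w i))
    (hwc : ∀ i, HasCompactSupport (w i)) (hwV : ∀ i, tsupport (w i) ⊆ V i) :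
    ∫ x in Ω, divergence (fun x => ∑ i, w i x) x = -∫ x, ⟪∑ i, w i x, ν x⟫ ∂μ := by
  simp_rw [sum_inner,
    divergence_sum Finset.univ fun i _ => (hw i).differentiable one_ne_zero]
  rw [integral_finsetSum _ fun i _ => (integrable_divergence (hw i) (hwc i)).integrableOn,
    integral_finsetSum _ fun i _ =>
      integrable_inner_of_hasCompactSupport hν (hw i).continuous (hwc i),
    ← Finset.sum_neg_distrib]
  exact Finset.sum_congr rfl fun i _ => h i _ (hw i) (hwc i) (hwV i)

theorem DivergenceFormulaOn.of_locally {W : Set (Euc n)} (hν : Integrable ν μ)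
    (h : ∀ x ∈ W, ∃ V, IsOpen V ∧ x ∈ V ∧ DivergenceFormulaOn Ω μ ν V) :
    DivergenceFormulaOn Ω μ ν W := by
  intro u hu huc hsupp
  choose! V hVo hxV hV using h
  obtain ⟨t, htW, ht⟩ := huc.isCompact.elim_nhds_subcover V
    fun x hx => (hVo x (hsupp hx)).mem_nhds (hxV x (hsupp hx))
  obtain ⟨f, hfd, hf, hf1⟩ := exists_contDiff_partition (isClosed_tsupport u)
    (V := fun x : t => V x) (fun x => hVo x (hsupp (htW x x.2))) (by rwa [iUnion_subtype])
  have hsum : ∀ x, ∑ i, f i x • u x = u x := fun x => by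
    by_cases hx : x ∈ tsupport u
    · rw [← Finset.sum_smul, hf1 x hx, one_smul]
    · simp [image_eq_zero_of_notMem_tsupport hx]
  simpa only [hsum] using setIntegral_divergence_sum (w := fun i x => f i x • u x) hν
    (fun i => hV i (hsupp (htW i i.2))) (fun i => (hfd i).smul hu)
    (fun i => huc.smul_left (f := f i)) fun i => (tsupport_smul_subset_left (f i) u).trans (hf i)

theorem divergenceFormulaOn_compl_frontier (hΩ : MeasurableSet Ω)
    (hμ : ∀ᵐ x ∂μ, x ∈ frontier Ω) : DivergenceFormulaOn Ω μ ν (frontier Ω)ᶜ := by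
  intro u hu huc hsupp
  rw [setIntegral_divergence_eq_zero hΩ hu huc hsupp, integral_eq_zero_of_ae, neg_zero]
  filter_upwards [hμ] with x hx
  have hux : u x = 0 := image_eq_zero_of_notMem_tsupport fun h => hsupp h hx
  rw [hux, inner_zero_left, Pi.zero_apply]

theorem LipschitzChart.divergenceFormulaOn {d : ℕ} {Ω : Set (Euc (d + 1))} (hΩ : MeasurableSet Ω)
    {c : LipschitzChart d} (hc : c.IsChartOf Ω) :
    DivergenceFormulaOn Ω (boundaryMeasure Ω) (necasNormal Ω) c.U := by
  intro u hu huc hsupp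
  rw [setIntegral_divergence_of_tsupport_subset hΩ hc hu huc hsupp]
  congr 1
  refine integral_congr_ae ?_
  filter_upwards [ae_isNecasNormal hc] with x hx
  by_cases hxU : x ∈ c.U
  · rw [(hx hxU).2.necasNormal_eq]
  · have hux : u x = 0 := image_eq_zero_of_notMem_tsupport fun h => hxU (hsupp h)
    rw [hux, inner_zero_left, inner_zero_left]

end DivergenceFormulaOn

/-! ### Null sets of codimension one are removable -/

section BallCover

open scoped ENNReal NNReal

theorem exists_radius_pow_le {a δ ε : ℝ≥0∞} (d : ℕ) (haδ : a < δ) (hε : 0 < ε) :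
    ∃ r : ℝ≥0, a < r ∧ r < δ ∧ (r : ℝ≥0∞) ^ d ≤ a ^ d + ε := by
  have hlt : a ^ d < a ^ d + ε := ENNReal.lt_add_right (ENNReal.pow_ne_top haδ.ne_top) hε.ne'
  have hnear := (((ENNReal.continuous_pow d).tendsto a).eventually_lt_const hlt).and
    (eventually_lt_nhds haδ)
  have := nhdsGT_neBot_of_exists_gt ⟨δ, haδ⟩
  obtain ⟨b, hab, hb⟩ := hnear.exists_gt
  exact ⟨b.toNNReal, by simpa [hb.2.ne_top] using ⟨hab, hb.2, hb.1.le⟩⟩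

variable {X : Type*} [MetricSpace X] [MeasurableSpace X] [BorelSpace X] {K : Set X} {δ ε : ℝ≥0∞}

theorem exists_cover_of_hausdorffMeasure_eq_zero {d : ℝ} (hKd : μH[d] K = 0) (hδ : 0 < δ)
    (hε : 0 < ε) :
    ∃ t : ℕ → Set X, K ⊆ ⋃ i, t i ∧ (∀ i, Metric.ediam (t i) < δ) ∧
      ∑' i, ⨆ _ : (t i).Nonempty, Metric.ediam (t i) ^ d < ε := by
  obtain ⟨δ', hδ'0, hδ'⟩ := exists_between hδ
  have hcover := (le_iSup₂ (f := fun (r : ℝ≥0∞) (_ : 0 < r) =>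
    ⨅ (t : ℕ → Set X) (_ : K ⊆ ⋃ i, t i) (_ : ∀ i, Metric.ediam (t i) ≤ r),
      ∑' i, ⨆ _ : (t i).Nonempty, Metric.ediam (t i) ^ d) δ' hδ'0).trans_lt
    (((Measure.hausdorffMeasure_apply d K).symm.trans hKd).trans_lt hε)
  simp only [iInf_lt_iff] at hcover
  obtain ⟨t, hKt, htδ, htε⟩ := hcover
  exact ⟨t, hKt, fun i => (htδ i).trans_lt hδ', htε⟩

theorem exists_finset_ball_cover (hK : IsCompact K) {d : ℕ} (hKd : (μH[d] : Measure X) K = 0)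
    (hδ : 0 < δ) (hε : 0 < ε) :
    ∃ (ι : Type) (s : Finset ι) (x : ι → X) (r : ι → ℝ≥0), (∀ i, x i ∈ K ∧ 0 < r i ∧ r i < δ) ∧
      K ⊆ ⋃ i ∈ s, Metric.ball (x i) (r i) ∧ ∑ i ∈ s, (r i : ℝ≥0∞) ^ d < ε := by
  obtain ⟨t, hKt, htδ, htε⟩ :=
    exists_cover_of_hausdorffMeasure_eq_zero hKd hδ (ENNReal.half_pos hε.ne')
  obtain ⟨ε', hε'0, hε'⟩ :=
    ENNReal.exists_pos_sum_of_countable' (ENNReal.half_pos hε.ne').ne' ℕ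
  choose r hr hrδ hrd using fun i => exists_radius_pow_le d (htδ i) (hε'0 i)
  choose x hx using fun i : {i // (K ∩ t i).Nonempty} => i.2
  obtain ⟨s, hKs⟩ := hK.elim_finite_subcover (fun i => Metric.ball (x i) (r i))
    (fun _ => Metric.isOpen_ball) (fun y hy => by
      obtain ⟨i, hi⟩ := mem_iUnion.1 (hKt hy)
      refine mem_iUnion.2 ⟨⟨i, y, hy, hi⟩, ?_⟩
      rw [← Metric.eball_coe]
      exact (Metric.edist_le_ediam_of_mem hi (hx ⟨i, y, hy, hi⟩).2).trans_lt (hr i))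
  refine ⟨_, s, x, fun i => r i, fun i => ⟨(hx i).1,
    ENNReal.coe_pos.1 (zero_le.trans_lt (hr i)), hrδ i⟩, hKs, ?_⟩
  calc ∑ i ∈ s, (r i : ℝ≥0∞) ^ d
      ≤ ∑ i ∈ s, ((⨆ _ : (t i).Nonempty, Metric.ediam (t i) ^ (d : ℝ)) + ε' i) := by
        refine Finset.sum_le_sum fun i _ => (hrd i).trans ?_
        rw [ciSup_pos i.2.right, ENNReal.rpow_natCast]
    _ ≤ ∑' i, ((⨆ _ : (t i).Nonempty, Metric.ediam (t i) ^ (d : ℝ)) + ε' i) :=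
        (ENNReal.sum_le_tsum s).trans
          (ENNReal.tsum_comp_le_tsum_of_injective Subtype.val_injective _)
    _ < ε := by
        rw [ENNReal.tsum_add, ← ENNReal.add_halves ε]
        exact ENNReal.add_lt_add htε hε'

end BallCover

section BallCutoff

variable {E : Type*} [NormedAddCommGroup E] [NormedSpace ℝ E] [HasContDiffBump E]

/-- The standard bump function of `E`, equal to `1` on the unit ball and supported in the ball of
radius `2`. -/
noncomputable def unitBump (E : Type*) [NormedAddCommGroup E] : ContDiffBump (0 : E) :=
  ⟨1, 2, one_pos, one_lt_two⟩

/-- A `C¹` function vanishing on the ball `B_r(x)` and equal to `1` off `B_{2r}(x)`, obtained from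
one fixed bump by scaling so that its gradient has `L¹` norm of order `r ^ (dim E - 1)`. -/
noncomputable def ballCutoff (x : E) (r : ℝ) (y : E) : ℝ := 1 - unitBump E (r⁻¹ • (y - x))

variable {x y : E} {r : ℝ}

theorem contDiff_ballCutoff : ContDiff ℝ 1 (ballCutoff x r) :=
  contDiff_const.sub ((unitBump E).contDiff.comp (by fun_prop))

theorem ballCutoff_mem_Icc : ballCutoff x r y ∈ Icc 0 1 :=
  ⟨sub_nonneg.2 (unitBump E).le_one, sub_le_self 1 (unitBump E).nonneg⟩

theorem ballCutoff_eq_zero (hr : 0 < r) (hy : y ∈ Metric.ball x r) : ballCutoff x r y = 0 := by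
  refine sub_eq_zero.2 ((unitBump E).one_of_mem_closedBall ?_).symm
  rw [mem_closedBall_zero_iff, norm_smul, norm_inv, Real.norm_of_nonneg hr.le,
    inv_mul_le_iff₀ hr]
  simpa [unitBump] using (mem_ball_iff_norm.1 hy).le

theorem ballCutoff_eq_one (hr : 0 < r) (hy : 2 * r ≤ dist y x) : ballCutoff x r y = 1 := by
  refine sub_eq_self.2 ((unitBump E).zero_of_le_dist ?_)
  rw [dist_zero_right, norm_smul, norm_inv, Real.norm_of_nonneg hr.le, le_inv_mul_iff₀ hr,
    ← dist_eq_norm, mul_comm]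
  exact hy

theorem fderiv_ballCutoff :
    fderiv ℝ (ballCutoff x r) y = -(r⁻¹ • fderiv ℝ (unitBump E) (r⁻¹ • (y - x))) := by
  unfold ballCutoff
  rw [fderiv_const_sub, fderiv_comp_sub (f := fun z => unitBump E (r⁻¹ • z)),
    fderiv_comp_smul (f := unitBump E)]

variable [FiniteDimensional ℝ E] [MeasurableSpace E] [BorelSpace E]
  (μ : Measure E) [μ.IsAddHaarMeasure]

theorem integrable_fderiv_ballCutoff (hr : 0 < r) : Integrable (fderiv ℝ (ballCutoff x r)) μ := by
  have hcont : Continuous (fderiv ℝ (unitBump E)) :=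
    (unitBump E).contDiff.continuous_fderiv (n := 1) one_ne_zero
  have hint := hcont.integrable_of_hasCompactSupport (μ := μ)
    ((unitBump E).hasCompactSupport.fderiv ℝ)
  simp_rw [funext fun y => fderiv_ballCutoff (x := x) (y := y) (r := r)]
  exact (((hint.comp_smul (inv_ne_zero hr.ne')).comp_sub_right x).smul r⁻¹).neg

theorem integral_norm_fderiv_ballCutoff (hr : 0 < r) {d : ℕ} (hd : Module.finrank ℝ E = d + 1) :
    ∫ y, ‖fderiv ℝ (ballCutoff x r) y‖ ∂μ = r ^ d * ∫ y, ‖fderiv ℝ (unitBump E) y‖ ∂μ := by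
  simp_rw [fderiv_ballCutoff, norm_neg, norm_smul, norm_inv, Real.norm_of_nonneg hr.le]
  rw [integral_const_mul,
    integral_sub_right_eq_self (fun y => ‖fderiv ℝ (unitBump E) (r⁻¹ • y)‖) x,
    Measure.integral_comp_inv_smul_of_nonneg μ (fun y => ‖fderiv ℝ (unitBump E) y‖) hr.le, hd,
    smul_eq_mul, pow_succ]
  field_simp

end BallCutoff

section Removable

open scoped ENNReal NNReal

theorem norm_fderiv_finsetProd_le {ι E : Type*} [NormedAddCommGroup E] [NormedSpace ℝ E]
    (s : Finset ι) {g : ι → E → ℝ} {y : E} (hg : ∀ i ∈ s, DifferentiableAt ℝ (g i) y)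
    (hg' : ∀ i ∈ s, g i y ∈ Icc 0 1) :
    ‖fderiv ℝ (fun z => ∏ i ∈ s, g i z) y‖ ≤ ∑ i ∈ s, ‖fderiv ℝ (g i) y‖ := by
  classical
  rw [fderiv_finsetProd hg]
  refine norm_sum_le_of_le s fun i _ => ?_
  rw [norm_smul, Real.norm_eq_abs, Finset.abs_prod]
  refine mul_le_of_le_one_left (norm_nonneg _) (Finset.prod_le_one (fun _ _ => abs_nonneg _) ?_)
  intro j hj
  obtain ⟨h0, h1⟩ := hg' j (Finset.mem_of_mem_erase hj)
  rwa [abs_of_nonneg h0]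

theorem tendsto_integral_clm_apply_of_bound {X E : Type*} [MeasurableSpace X]
    [NormedAddCommGroup E] [NormedSpace ℝ E] {μ : Measure X} {L : ℕ → X → E →L[ℝ] ℝ} {u : X → E}
    {M : ℝ} (hL : ∀ k, Integrable (L k) μ) (hM : ∀ x, ‖u x‖ ≤ M)
    (hsmall : Tendsto (fun k => ∫ x, ‖L k x‖ ∂μ) atTop (𝓝 0)) (s : Set X) :
    Tendsto (fun k => ∫ x in s, L k x (u x) ∂μ) atTop (𝓝 0) := by
  refine squeeze_zero_norm (fun k => ?_) (by simpa using hsmall.mul_const M)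
  rw [← integral_mul_const]
  have hint : Integrable (fun x => ‖L k x‖ * M) μ := (hL k).norm.mul_const M
  have hbound : ∀ x, ‖L k x (u x)‖ ≤ ‖L k x‖ * M := fun x => (L k x).le_opNorm_of_le (hM x)
  exact (norm_integral_le_of_norm_le hint.restrict (ae_of_all _ hbound)).trans
    (setIntegral_le_integral hint (ae_of_all _ fun x => (norm_nonneg _).trans (hbound x)))

variable {E : Type*} [NormedAddCommGroup E] [NormedSpace ℝ E] [FiniteDimensional ℝ E]

theorem norm_fderiv_prod_ballCutoff_le {ι : Type*} (s : Finset ι) (x : ι → E) (r : ι → ℝ) (y : E) :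
    ‖fderiv ℝ (fun y => ∏ i ∈ s, ballCutoff (x i) (r i) y) y‖ ≤
      ∑ i ∈ s, ‖fderiv ℝ (ballCutoff (x i) (r i)) y‖ :=
  norm_fderiv_finsetProd_le s (fun _ _ => contDiff_ballCutoff.differentiable one_ne_zero y)
    fun _ _ => ballCutoff_mem_Icc

theorem contDiff_prod_ballCutoff {ι : Type*} (s : Finset ι) (x : ι → E) (r : ι → ℝ) :
    ContDiff ℝ 1 fun y => ∏ i ∈ s, ballCutoff (x i) (r i) y :=
  contDiff_prod fun _ _ => contDiff_ballCutoff

variable [MeasurableSpace E] [BorelSpace E] (μ : Measure E) [μ.IsAddHaarMeasure] {K : Set E}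
  {d : ℕ}

theorem integrable_fderiv_prod_ballCutoff {ι : Type*} (s : Finset ι) (x : ι → E) {r : ι → ℝ}
    (hr : ∀ i, 0 < r i) :
    Integrable (fderiv ℝ fun y => ∏ i ∈ s, ballCutoff (x i) (r i) y) μ :=
  (integrable_finsetSum s fun i _ => (integrable_fderiv_ballCutoff μ (hr i)).norm).mono'
    ((contDiff_prod_ballCutoff s x r).continuous_fderiv one_ne_zero).aestronglyMeasurable
    (ae_of_all _ (norm_fderiv_prod_ballCutoff_le s x r))

theorem integral_norm_fderiv_prod_ballCutoff_le (hd : Module.finrank ℝ E = d + 1) {ι : Type*}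
    (s : Finset ι) (x : ι → E) {r : ι → ℝ} (hr : ∀ i, 0 < r i) :
    ∫ y, ‖fderiv ℝ (fun y => ∏ i ∈ s, ballCutoff (x i) (r i) y) y‖ ∂μ ≤
      (∑ i ∈ s, r i ^ d) * ∫ y, ‖fderiv ℝ (unitBump E) y‖ ∂μ := by
  have hint : ∀ i ∈ s, Integrable (fun y => ‖fderiv ℝ (ballCutoff (x i) (r i)) y‖) μ :=
    fun i _ => (integrable_fderiv_ballCutoff μ (hr i)).norm
  refine (integral_mono (integrable_fderiv_prod_ballCutoff μ s x hr).norm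
    (integrable_finsetSum s hint) (norm_fderiv_prod_ballCutoff_le s x r)).trans_eq ?_
  rw [integral_finsetSum s hint, Finset.sum_mul]
  exact Finset.sum_congr rfl fun i _ => integral_norm_fderiv_ballCutoff μ (hr i) hd

/-- The product of the cutoffs of a finite cover of `K` by small balls: since `K` is null in
codimension one, the gradients of the factors have small total mass. -/
theorem exists_cutoff (hd : Module.finrank ℝ E = d + 1) (hK : IsCompact K)
    (hKd : (μH[d] : Measure E) K = 0) {δ ε : ℝ} (hδ : 0 < δ) (hε : 0 < ε) :
    ∃ η : E → ℝ, ContDiff ℝ 1 η ∧ (∀ y, η y ∈ Icc 0 1) ∧ (∀ y ∈ K, η =ᶠ[𝓝 y] 0) ∧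
      (∀ y, (∀ x ∈ K, δ ≤ dist y x) → η y = 1) ∧ Integrable (fderiv ℝ η) μ ∧
        ∫ y, ‖fderiv ℝ η y‖ ∂μ < ε := by
  set I := ∫ y, ‖fderiv ℝ (unitBump E) y‖ ∂μ
  have : 0 ≤ I := integral_nonneg fun y => norm_nonneg _
  obtain ⟨ι, s, x, r, hr, hKs, hsum⟩ := exists_finset_ball_cover hK hKd
    (ENNReal.ofReal_pos.2 (half_pos hδ)) (ENNReal.ofReal_pos.2 (show 0 < ε / (I + 1) by positivity))
  have hrpos : ∀ i, 0 < (r i : ℝ) := fun i => (hr i).2.1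
  have h01 : ∀ i y, ballCutoff (x i) (r i) y ∈ Icc 0 1 := fun _ _ => ballCutoff_mem_Icc
  refine ⟨_, contDiff_prod_ballCutoff s x fun i => r i, fun y => ⟨?_, ?_⟩, fun y hy => ?_,
    fun y hy => ?_, integrable_fderiv_prod_ballCutoff μ s x hrpos, ?_⟩
  · exact Finset.prod_nonneg fun i _ => (h01 i y).1
  · exact Finset.prod_le_one (fun i _ => (h01 i y).1) fun i _ => (h01 i y).2
  · obtain ⟨i, hi, hyi⟩ := mem_iUnion₂.1 (hKs hy)
    filter_upwards [Metric.isOpen_ball.mem_nhds hyi] with z hz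
    exact Finset.prod_eq_zero hi (ballCutoff_eq_zero (hrpos i) hz)
  · refine Finset.prod_eq_one fun i _ => ballCutoff_eq_one (hrpos i) ?_
    have hrδ : (r i : ℝ) < δ / 2 := by
      simpa [ENNReal.coe_lt_ofReal, Real.lt_toNNReal_iff_coe_lt] using (hr i).2.2
    linarith [hy (x i) (hr i).1]
  · have hsum' : ∑ i ∈ s, (r i : ℝ) ^ d < ε / (I + 1) := by
      rw [← ENNReal.ofReal_lt_ofReal_iff (by positivity), ENNReal.ofReal_sum_of_nonneg
        fun i _ => by positivity]
      simpa [ENNReal.ofReal_pow] using hsum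
    calc _ ≤ (∑ i ∈ s, (r i : ℝ) ^ d) * I :=
          integral_norm_fderiv_prod_ballCutoff_le μ hd s x hrpos
      _ ≤ ε / (I + 1) * I := by gcongr
      _ < ε := by
        rw [div_mul_eq_mul_div, div_lt_iff₀ (by positivity)]
        linarith

theorem exists_seq_cutoff (hd : Module.finrank ℝ E = d + 1) (hK : IsCompact K)
    (hKd : (μH[d] : Measure E) K = 0) :
    ∃ η : ℕ → E → ℝ, (∀ k, ContDiff ℝ 1 (η k)) ∧ (∀ k y, η k y ∈ Icc 0 1) ∧
      (∀ k, ∀ y ∈ K, η k =ᶠ[𝓝 y] 0) ∧ (∀ y ∉ K, ∀ᶠ k in atTop, η k y = 1) ∧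
        (∀ k, Integrable (fderiv ℝ (η k)) μ) ∧
          Tendsto (fun k => ∫ y, ‖fderiv ℝ (η k) y‖ ∂μ) atTop (𝓝 0) := by
  choose η hη h01 hη0 hη1 hint hsmall using fun k : ℕ =>
    exists_cutoff μ hd hK hKd (δ := 1 / (k + 1)) (ε := 1 / (k + 1)) (by positivity) (by positivity)
  refine ⟨η, hη, h01, hη0, fun y hy => ?_, hint, ?_⟩
  · obtain ⟨δ, hδ, hball⟩ := Metric.isOpen_iff.1 hK.isClosed.isOpen_compl y hy
    filter_upwards [tendsto_one_div_add_atTop_nhds_zero_nat.eventually_lt_const hδ] with k hk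
    refine hη1 k y fun x hx => le_of_not_gt fun hlt => hball ?_ hx
    exact Metric.mem_ball'.2 (hlt.trans hk)
  · exact squeeze_zero (fun k => integral_nonneg fun y => norm_nonneg _) (fun k => (hsmall k).le)
      tendsto_one_div_add_atTop_nhds_zero_nat

theorem tendsto_integral_mul_of_ae_eventually_eq_one {X : Type*} [MeasurableSpace X]
    {μ : Measure X} {f : X → ℝ} {η : ℕ → X → ℝ} (hf : Integrable f μ)
    (hη : ∀ k, AEStronglyMeasurable (η k) μ) (h01 : ∀ k x, η k x ∈ Icc 0 1)
    (h1 : ∀ᵐ x ∂μ, ∀ᶠ k in atTop, η k x = 1) :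
    Tendsto (fun k => ∫ x, η k x * f x ∂μ) atTop (𝓝 (∫ x, f x ∂μ)) := by
  refine tendsto_integral_of_dominated_convergence (fun x => ‖f x‖) (fun k => (hη k).mul hf.1)
    hf.norm (fun k => ae_of_all _ fun x => ?_) (h1.mono fun x hx => ?_)
  · rw [norm_mul, Real.norm_of_nonneg (h01 k x).1]
    exact mul_le_of_le_one_left (norm_nonneg _) (h01 k x).2
  · exact tendsto_const_nhds.congr' (hx.mono fun k hk => by simp only [hk, one_mul])

theorem ae_notMem_of_euclideanHausdorffMeasure_eq_zero {d : ℕ} {K : Set (Euc (d + 1))}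
    (hKd : μHE[d] K = 0) : ∀ᵐ x, x ∉ K := by
  have h := (Measure.euclideanHausdorffMeasure_zero_or_top (Nat.lt_succ_self d) K).resolve_right
    (hKd.trans_ne ENNReal.zero_ne_top)
  rwa [EuclideanSpace.euclideanHausdorffMeasure_eq_volume, measure_eq_zero_iff_ae_notMem] at h

theorem hausdorffMeasure_eq_zero_of_euclideanHausdorffMeasure_eq_zero {X : Type*}
    [MetricSpace X] [MeasurableSpace X] [BorelSpace X] {d : ℕ} {K : Set X} (hKd : μHE[d] K = 0) :
    (μH[d] : Measure X) K = 0 := by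
  rw [Measure.euclideanHausdorffMeasure_def, Measure.smul_apply] at hKd
  exact (smul_eq_zero.1 hKd).resolve_left
    (Measure.addHaarScalarFactor_volume_hausdorffMeasure_ne_zero d)

theorem tsupport_smul_subset_compl {n : ℕ} {K : Set (Euc n)} {η : Euc n → ℝ} {u : Euc n → Euc n}
    (hη : ∀ y ∈ K ∩ tsupport u, η =ᶠ[𝓝 y] 0) : tsupport (fun x => η x • u x) ⊆ Kᶜ := by
  intro y hy hyK
  refine (tsupport_smul_subset_left η u hy) |> notMem_tsupport_iff_eventuallyEq.2 (hη y ⟨hyK, ?_⟩)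
  exact tsupport_smul_subset_right η u hy

variable {d : ℕ} {Ω K : Set (Euc (d + 1))} {μ : Measure (Euc (d + 1))}
  {ν : Euc (d + 1) → Euc (d + 1)}

theorem DivergenceFormulaOn.univ_of_compl (hK : IsClosed K) (hKd : μHE[d] K = 0) (hμK : μ K = 0)
    (hν : Integrable ν μ) (h : DivergenceFormulaOn Ω μ ν Kᶜ) :
    DivergenceFormulaOn Ω μ ν univ := by
  intro u hu huc _
  obtain ⟨η, hη, h01, hη0, hη1, hint, hsmall⟩ := exists_seq_cutoff volume
    (finrank_euclideanSpace_fin (𝕜 := ℝ)) (huc.isCompact.inter_left hK)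
    (hausdorffMeasure_eq_zero_of_euclideanHausdorffMeasure_eq_zero
      (measure_mono_null inter_subset_left hKd))
  have hone : ∀ y ∉ K, ∀ᶠ k in atTop, η k y = 1 := fun y hy => hη1 y fun hy' => hy hy'.1
  have hdiv : Tendsto (fun k => ∫ x in Ω, η k x * divergence u x) atTop
      (𝓝 (∫ x in Ω, divergence u x)) :=
    tendsto_integral_mul_of_ae_eventually_eq_one (integrable_divergence hu huc).integrableOn
      (fun k => (hη k).continuous.aestronglyMeasurable) h01
      (ae_restrict_of_ae ((ae_notMem_of_euclideanHausdorffMeasure_eq_zero hKd).mono hone))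
  have hinner : Tendsto (fun k => ∫ x, η k x * ⟪u x, ν x⟫ ∂μ) atTop (𝓝 (∫ x, ⟪u x, ν x⟫ ∂μ)) :=
    tendsto_integral_mul_of_ae_eventually_eq_one
      (integrable_inner_of_hasCompactSupport hν hu.continuous huc)
      (fun k => (hη k).continuous.aestronglyMeasurable) h01
      ((measure_eq_zero_iff_ae_notMem.1 hμK).mono hone)
  obtain ⟨M, hM⟩ := hu.continuous.bounded_above_of_compact_support huc
  have hgrad := tendsto_integral_clm_apply_of_bound hint hM hsmall Ω
  have hformula : ∀ k, (∫ x in Ω, η k x * divergence u x) + ∫ x in Ω, fderiv ℝ (η k) x (u x) =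
      -∫ x, η k x * ⟪u x, ν x⟫ ∂μ := fun k => by
    have hk := h (fun x => η k x • u x) ((hη k).smul hu) (huc.smul_left (f := η k))
      (tsupport_smul_subset_compl (hη0 k))
    have hint₁ : Integrable fun x => η k x * divergence u x :=
      (integrable_divergence hu huc).bdd_mul (c := 1)
        (hη k).continuous.aestronglyMeasurable (ae_of_all _ fun x => by
          rw [Real.norm_of_nonneg (h01 k x).1]
          exact (h01 k x).2)
    have hint₂ : Integrable fun x => fderiv ℝ (η k) x (u x) :=
      (ContinuousLinearMap.id ℝ (Euc (d + 1) →L[ℝ] ℝ)).integrable_of_bilin_of_bdd_right M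
        (hint k) hu.continuous.aestronglyMeasurable (ae_of_all _ hM)
    simp_rw [divergence_smul ((hη k).differentiable one_ne_zero _)
      (hu.differentiable one_ne_zero _), real_inner_smul_left] at hk
    rwa [integral_add hint₁.integrableOn hint₂.integrableOn] at hk
  simpa only [add_zero] using tendsto_nhds_unique ((hdiv.add hgrad).congr hformula) hinner.neg

end Removable

section Stokes

variable {d : ℕ} {Ω : Set (Euc (d + 1))}

theorem ae_boundaryMeasure_iff {p : Euc (d + 1) → Prop} :
    (∀ᵐ x ∂boundaryMeasure Ω, p x) ↔ μHE[d] (frontier Ω \ {x | p x}) = 0 := by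
  rw [boundaryMeasure, ae_restrict_iff' isClosed_frontier.measurableSet, ae_iff]
  exact iff_of_eq (congrArg (μHE[d] · = 0) (ext fun _ => Classical.not_imp))

theorem stokesFormula_necasNormal [IsFiniteMeasure (boundaryMeasure Ω)] (hΩ : MeasurableSet Ω)
    (hlip : ∀ᵐ x ∂boundaryMeasure Ω, IsLipschitzAt Ω x) : StokesFormula Ω (necasNormal Ω) := by
  have hLp := memLp_top_necasNormal hlip
  have hint : Integrable (necasNormal Ω) (boundaryMeasure Ω) := hLp.integrable le_top
  have hnull := ae_boundaryMeasure_iff.1 hlip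
  have hregular : DivergenceFormulaOn Ω (boundaryMeasure Ω) (necasNormal Ω)
      (frontier Ω \ {x | IsLipschitzAt Ω x})ᶜ := by
    refine .of_locally hint fun x hx => ?_
    by_cases hxf : x ∈ frontier Ω
    · obtain ⟨c, hc, hxc⟩ := not_not.1 fun h => hx ⟨hxf, h⟩
      exact ⟨c.U, c.isOpen_U, hxc, LipschitzChart.divergenceFormulaOn hΩ hc⟩
    · exact ⟨_, isClosed_frontier.isOpen_compl, hxf,
        divergenceFormulaOn_compl_frontier hΩ (ae_restrict_mem isClosed_frontier.measurableSet)⟩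
  exact ⟨hLp, fun u hu huc => hregular.univ_of_compl
    (isClosed_frontier.sdiff isOpen_setOf_isLipschitzAt) hnull
    (le_antisymm ((Measure.restrict_apply_le _ _).trans_eq hnull) zero_le) hint u hu huc
    (subset_univ _)⟩

theorem StokesFormula.congr {ν ν' : Euc (d + 1) → Euc (d + 1)} (h : StokesFormula Ω ν)
    (hν : ν =ᵐ[boundaryMeasure Ω] ν') : StokesFormula Ω ν' := by
  refine ⟨(memLp_congr_ae hν).1 h.1, fun u hu huc => (h.2 u hu huc).trans ?_⟩
  exact congrArg Neg.neg (integral_congr_ae (hν.mono fun x hx => by simp only [hx]))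

end Stokes

/-! ### Vector measures -/

section VectorMeasures

variable {X : Type*} [MeasurableSpace X]

section FiniteDimensional

variable {ι E : Type*} [NormedAddCommGroup E] [NormedSpace ℝ E] [FiniteDimensional ℝ E]

/-- The signed measure formed by the `i`-th coordinates, in the basis `b`, of the values of a
vector measure. -/
noncomputable def vectorMeasureCoord (b : Module.Basis ι ℝ E)
    (D : VectorMeasure X E) (i : ι) : SignedMeasure X :=
  D.mapRange (b.coord i).toAddMonoidHom (b.coord i).continuous_of_finiteDimensional

theorem sum_vectorMeasureCoord_smul [Fintype ι] (b : Module.Basis ι ℝ E)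
    (D : VectorMeasure X E) (s : Set X) :
    ∑ i, vectorMeasureCoord b D i s • b i = D s :=
  b.sum_repr (D s)

theorem variation_le_sum_variation_vectorMeasureCoord [Fintype ι]
    (b : Module.Basis ι ℝ E) (D : VectorMeasure X E) :
    D.variation ≤ ∑ i, ‖b i‖ₑ • (vectorMeasureCoord b D i).variation := by
  refine VectorMeasure.variation_le_of_forall_enorm_le fun s _ => ?_
  rw [Measure.coe_finsetSum, Finset.sum_apply, ← sum_vectorMeasureCoord_smul b D s]
  refine (enorm_sum_le _ _).trans (Finset.sum_le_sum fun i _ => ?_)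
  rw [enorm_smul, mul_comm, Measure.smul_apply, smul_eq_mul]
  gcongr
  exact VectorMeasure.enorm_measure_le_variation _ s

instance isFiniteMeasure_variation (D : VectorMeasure X E) : IsFiniteMeasure D.variation := by
  have hfin : ∀ i, (vectorMeasureCoord (Module.finBasis ℝ E) D i).variation univ < ⊤ := fun i => by
    rw [← SignedMeasure.totalVariation_eq_variation, SignedMeasure.totalVariation]
    exact measure_lt_top _ _
  refine ⟨(variation_le_sum_variation_vectorMeasureCoord (Module.finBasis ℝ E) D univ).trans_lt ?_⟩
  rw [Measure.coe_finsetSum, Finset.sum_apply]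
  exact ENNReal.sum_lt_top.2 fun i _ => ENNReal.mul_lt_top enorm_lt_top (hfin i)

theorem withDensityᵥ_rnDeriv_vectorMeasureCoord (b : Module.Basis ι ℝ E) (D : VectorMeasure X E)
    (i : ι) :
    D.variation.withDensityᵥ ((vectorMeasureCoord b D i).rnDeriv D.variation) =
      vectorMeasureCoord b D i := by
  refine SignedMeasure.withDensityᵥ_rnDeriv_eq _ _
    (VectorMeasure.AbsolutelyContinuous.mk fun s hs h0 => ?_)
  rw [Measure.toENNRealVectorMeasure_apply_measurable hs] at h0
  have hD : D s = 0 := enorm_eq_zero.1 <|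
    le_antisymm ((VectorMeasure.enorm_measure_le_variation D s).trans_eq h0) zero_le
  exact (congrArg (b.coord i) hD).trans (map_zero _)

theorem exists_withDensityᵥ_variation_eq (D : VectorMeasure X E) :
    ∃ h : X → E, Integrable h D.variation ∧ D.variation.withDensityᵥ h = D := by
  set b := Module.finBasis ℝ E
  set g := fun i => (vectorMeasureCoord b D i).rnDeriv D.variation
  have hg : ∀ i, Integrable (g i) D.variation := fun i => SignedMeasure.integrable_rnDeriv _ _
  have hint : Integrable (fun x => ∑ i, g i x • b i) D.variation :=
    integrable_finsetSum _ fun i _ => (hg i).smul_const _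
  refine ⟨_, hint, ?_⟩
  ext1 s hs
  rw [withDensityᵥ_apply hint hs,
    integral_finsetSum _ fun i _ => ((hg i).smul_const _).integrableOn,
    ← sum_vectorMeasureCoord_smul b D s]
  refine Finset.sum_congr rfl fun i _ => ?_
  rw [integral_smul_const, ← withDensityᵥ_apply (hg i) hs,
    withDensityᵥ_rnDeriv_vectorMeasureCoord]

end FiniteDimensional

section IntegralWithDensity

variable {E F G : Type*} [NormedAddCommGroup E] [NormedSpace ℝ E] [NormedAddCommGroup F]
  [NormedSpace ℝ F] [CompleteSpace F] [NormedAddCommGroup G] [NormedSpace ℝ G]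
  {μ : Measure X} {h : X → F}

theorem isFiniteMeasure_variation_withDensityᵥ (hh : Integrable h μ) :
    IsFiniteMeasure (μ.withDensityᵥ h).variation := by
  rw [Measure.variation_withDensityᵥ hh]
  exact isFiniteMeasure_withDensity hh.2.ne

variable [CompleteSpace G] (B : E →L[ℝ] F →L[ℝ] G)

theorem integral_withDensityᵥ_simpleFunc (hh : Integrable h μ) (f : SimpleFunc X E) :
    ∫ᵛ x, f x ∂[B; μ.withDensityᵥ h] = ∫ x, B (f x) (h x) ∂μ := by
  have := isFiniteMeasure_variation_withDensityᵥ hh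
  have hint : ∀ f : SimpleFunc X E, Integrable (fun x => B (f x) (h x)) μ := fun f =>
    have ⟨C, hC⟩ := f.exists_forall_norm_le
    B.integrable_of_bilin_of_bdd_left C f.stronglyMeasurable.aestronglyMeasurable
      (ae_of_all _ hC) hh
  induction f using SimpleFunc.induction with
  | @const c s hs =>
    have hpiece : ∀ x, SimpleFunc.piecewise s hs (.const X c) (.const X 0) x =
        s.indicator (fun _ => c) x := fun _ => rfl
    have hB : ∀ x, B (s.indicator (fun _ => c) x) (h x) = s.indicator (fun x => B c (h x)) x :=
      fun x => by by_cases hx : x ∈ s <;> simp [hx]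
    simp_rw [hpiece, hB]
    rw [VectorMeasure.integral_indicator_const _ hs, integral_indicator hs,
      withDensityᵥ_apply hh hs, (B c).integral_comp_comm hh.integrableOn]
  | @add f g _ hf hg =>
    simp only [SimpleFunc.coe_add, Pi.add_apply, map_add, add_apply]
    rw [integral_add (hint f) (hint g), ← hf, ← hg]
    exact VectorMeasure.integral_fun_add (SimpleFunc.integrable_of_isFiniteMeasure f)
      (SimpleFunc.integrable_of_isFiniteMeasure g)

theorem integral_withDensityᵥ (hh : Integrable h μ) {u : X → E} (hu : StronglyMeasurable u)
    (hbdd : ∃ C, ∀ x, ‖u x‖ ≤ C) :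
    ∫ᵛ x, u x ∂[B; μ.withDensityᵥ h] = ∫ x, B (u x) (h x) ∂μ := by
  have := isFiniteMeasure_variation_withDensityᵥ hh
  obtain ⟨C, hC0, hC⟩ : ∃ C, 0 ≤ C ∧ ∀ x, ‖u x‖ ≤ C :=
    have ⟨C, hC⟩ := hbdd
    ⟨|C|, abs_nonneg C, fun x => (hC x).trans (le_abs_self C)⟩
  have hlim : ∀ x, Tendsto (fun k => hu.approxBounded C k x) atTop (𝓝 (u x)) := fun x =>
    hu.tendsto_approxBounded_of_norm_le (hC x)
  have hb : ∀ k x, ‖hu.approxBounded C k x‖ ≤ C := fun k x => hu.norm_approxBounded_le hC0 k x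
  have hleft : Tendsto (fun k => ∫ᵛ x, hu.approxBounded C k x ∂[B; μ.withDensityᵥ h]) atTop
      (𝓝 (∫ᵛ x, u x ∂[B; μ.withDensityᵥ h])) :=
    VectorMeasure.tendsto_integral_of_dominated_convergence (fun _ => C)
      (fun k => (hu.approxBounded C k).stronglyMeasurable.aestronglyMeasurable)
      (integrable_const C) (fun k => ae_of_all _ (hb k)) (ae_of_all _ hlim)
  have hright : Tendsto (fun k => ∫ x, B (hu.approxBounded C k x) (h x) ∂μ) atTop
      (𝓝 (∫ x, B (u x) (h x) ∂μ)) := by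
    refine tendsto_integral_of_dominated_convergence (fun x => ‖B‖ * C * ‖h x‖)
      (fun k => B.aestronglyMeasurable_comp₂
        (hu.approxBounded C k).stronglyMeasurable.aestronglyMeasurable hh.1)
      (hh.norm.const_mul _) (fun k => ae_of_all _ fun x => ?_) (ae_of_all _ fun x => ?_)
    · exact B.le_of_opNorm₂_le_of_le le_rfl (hb k x) le_rfl
    · exact (B.flip (h x)).continuous.continuousAt.tendsto.comp (hlim x)
  exact tendsto_nhds_unique (hleft.congr fun k => integral_withDensityᵥ_simpleFunc B hh _) hright

end IntegralWithDensity

end VectorMeasures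

/-! ### Uniqueness of the distributional gradient -/

section Uniqueness

theorem ae_eq_zero_of_integral_inner_contDiff_eq_zero {E : Type*} [NormedAddCommGroup E]
    [InnerProductSpace ℝ E] [FiniteDimensional ℝ E] [MeasurableSpace E] [BorelSpace E]
    {m : Measure E} {g : E → E} (hg : Integrable g m)
    (h : ∀ u : E → E, ContDiff ℝ 1 u → HasCompactSupport u → ∫ x, ⟪u x, g x⟫ ∂m = 0) :
    ∀ᵐ x ∂m, g x = 0 := by
  refine ae_eq_zero_of_integral_contDiff_smul_eq_zero hg.locallyIntegrable fun f hf hfc => ?_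
  refine ext_inner_left ℝ fun v => ?_
  have hfg : Integrable (fun x => f x • g x) m :=
    have ⟨C, hC⟩ := hf.continuous.bounded_above_of_compact_support hfc
    hg.bdd_smul C hf.continuous.aestronglyMeasurable (ae_of_all _ hC)
  have hf1 : ContDiff ℝ 1 f := hf.of_le (by exact_mod_cast le_top)
  rw [inner_zero_right, ← integral_inner hfg,
    ← h (fun x => f x • v) (hf1.smul contDiff_const) (hfc.smul_right (f' := fun _ => v))]
  simp only [real_inner_smul_left, real_inner_smul_right]

variable {n : ℕ} {D D' : VectorMeasure (Euc n) (Euc n)}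

theorem vectorMeasure_eq_zero_of_integral_contDiff_eq_zero
    (h : ∀ u : Euc n → Euc n, ContDiff ℝ 1 u → HasCompactSupport u →
      ∫ᵛ x, u x ∂[innerSL ℝ; D] = 0) : D = 0 := by
  obtain ⟨g, hg, hgD⟩ := exists_withDensityᵥ_variation_eq D
  have hg0 : g =ᵐ[D.variation] 0 :=
    ae_eq_zero_of_integral_inner_contDiff_eq_zero hg fun u hu huc => by
      have hbdd := hu.continuous.bounded_above_of_compact_support huc
      have hint := integral_withDensityᵥ (innerSL ℝ) hg hu.continuous.stronglyMeasurable hbdd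
      rw [hgD, h u hu huc] at hint
      exact hint.symm
  rw [← hgD, WithDensityᵥEq.congr_ae hg0, withDensityᵥ_zero]

theorem IsIndicatorGradient.unique {Ω : Set (Euc n)} (h : IsIndicatorGradient Ω D)
    (h' : IsIndicatorGradient Ω D') : D = D' := by
  refine sub_eq_zero.1 (vectorMeasure_eq_zero_of_integral_contDiff_eq_zero fun u hu huc => ?_)
  have hint : ∀ D : VectorMeasure (Euc n) (Euc n), Integrable u D.variation := fun D =>
    hu.continuous.integrable_of_hasCompactSupport huc
  rw [VectorMeasure.integral_sub_vectorMeasure (hint D) (hint D'), sub_eq_zero]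
  exact neg_injective ((h u hu huc).symm.trans (h' u hu huc))

end Uniqueness

/-! ### The normal of De Giorgi as a density -/

section BallAverages

variable {X F : Type*} [MeasurableSpace X] [NormedAddCommGroup F] [NormedSpace ℝ F]
  {m : Measure X} {f : X → F}

theorem tendsto_setIntegral_closedBall_nhdsLT [PseudoMetricSpace X] [OpensMeasurableSpace X]
    (hf : Integrable f m) (x : X) (r : ℝ) :
    Tendsto (fun s => ∫ y in Metric.closedBall x s, f y ∂m) (𝓝[<] r)
      (𝓝 (∫ y in Metric.ball x r, f y ∂m)) := by
  simp_rw [← integral_indicator Metric.isClosed_closedBall.measurableSet,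
    ← integral_indicator Metric.isOpen_ball.measurableSet]
  refine tendsto_integral_filter_of_dominated_convergence (fun y => ‖f y‖)
    (.of_forall fun s => hf.1.indicator Metric.isClosed_closedBall.measurableSet)
    (.of_forall fun s => ae_of_all _ fun y => norm_indicator_le_norm_self _ _)
    hf.norm (ae_of_all _ fun y => tendsto_const_nhds.congr' ?_)
  by_cases hy : y ∈ Metric.ball x r
  · filter_upwards [Ioo_mem_nhdsLT (Metric.mem_ball.1 hy)] with s hs
    rw [indicator_of_mem hy, indicator_of_mem (Metric.mem_closedBall.2 hs.1.le)]
  · filter_upwards [self_mem_nhdsWithin] with s hs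
    rw [indicator_of_notMem hy, indicator_of_notMem fun h =>
      hy (Metric.closedBall_subset_ball hs h)]

theorem tendsto_setAverage_closedBall_nhdsLT [PseudoMetricSpace X] [OpensMeasurableSpace X]
    [IsFiniteMeasure m] (hf : Integrable f m) {x : X} {r : ℝ} (hr : m (Metric.ball x r) ≠ 0) :
    Tendsto (fun s => ⨍ y in Metric.closedBall x s, f y ∂m) (𝓝[<] r)
      (𝓝 (⨍ y in Metric.ball x r, f y ∂m)) := by
  have hreal : Tendsto (fun s => m.real (Metric.closedBall x s)) (𝓝[<] r)
      (𝓝 (m.real (Metric.ball x r))) := by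
    simpa using tendsto_setIntegral_closedBall_nhdsLT (integrable_const (μ := m) (1 : ℝ)) x r
  simp_rw [setAverage_eq]
  exact (hreal.inv₀ ((measureReal_ne_zero_iff).2 hr)).smul
    (tendsto_setIntegral_closedBall_nhdsLT hf x r)

theorem ae_tendsto_setAverage_ball [MetricSpace X] [SecondCountableTopology X]
    [HasBesicovitchCovering X] [BorelSpace X] [CompleteSpace F] [IsFiniteMeasure m]
    (hf : Integrable f m) :
    ∀ᵐ x ∂m, Tendsto (fun r => ⨍ y in Metric.ball x r, f y ∂m) (𝓝[>] 0) (𝓝 (f x)) := by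
  filter_upwards [(Besicovitch.vitaliFamily m).ae_tendsto_average hf.locallyIntegrable,
    m.support_mem_ae] with x hx hxs
  have hclosed : Tendsto (fun r => ⨍ y in Metric.closedBall x r, f y ∂m) (𝓝[>] 0) (𝓝 (f x)) :=
    hx.comp (Besicovitch.tendsto_filterAt m x)
  refine Metric.nhds_basis_closedBall.tendsto_right_iff.2 fun ε hε => ?_
  obtain ⟨δ, hδ, h⟩ := mem_nhdsGT_iff_exists_Ioo_subset.1
    (hclosed.eventually (Metric.closedBall_mem_nhds (f x) hε))
  filter_upwards [Ioo_mem_nhdsGT hδ] with r hr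
  have hpos := (Measure.mem_support_iff_forall x).1 hxs _ (Metric.ball_mem_nhds x hr.1)
  refine Metric.isClosed_closedBall.mem_of_tendsto
    (tendsto_setAverage_closedBall_nhdsLT hf hpos.ne') ?_
  filter_upwards [Ioo_mem_nhdsLT hr.1] with s hs
  exact h ⟨hs.1, hs.2.trans hr.2⟩

end BallAverages

section DeGiorgiNormal

variable {n : ℕ} {μ : Measure (Euc n)} {ν : Euc n → Euc n}

theorem variation_withDensityᵥ_of_ae_norm_eq_one {X E : Type*} [MeasurableSpace X]
    [NormedAddCommGroup E] [NormedSpace ℝ E] [CompleteSpace E] {μ : Measure X} {ν : X → E}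
    (hν : Integrable ν μ) (hν1 : ∀ᵐ x ∂μ, ‖ν x‖ = 1) : (μ.withDensityᵥ ν).variation = μ := by
  have h1 : (fun x => ‖ν x‖ₑ) =ᵐ[μ] 1 := hν1.mono fun x hx => by simp [← ofReal_norm, hx]
  rw [Measure.variation_withDensityᵥ hν, withDensity_congr_ae h1, withDensity_one]

variable [IsFiniteMeasure μ] (hν : Integrable ν μ) (hν1 : ∀ᵐ x ∂μ, ‖ν x‖ = 1)
include hν hν1

theorem ae_tendsto_ballRatio_withDensityᵥ :
    ∀ᵐ x ∂μ, Tendsto (ballRatio (μ.withDensityᵥ ν) x) (𝓝[>] 0) (𝓝 (ν x)) := by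
  have hratio : ∀ x r, ⨍ y in Metric.ball x r, ν y ∂μ = ballRatio (μ.withDensityᵥ ν) x r :=
    fun x r => by
      rw [ballRatio, variation_withDensityᵥ_of_ae_norm_eq_one hν hν1,
        withDensityᵥ_apply hν Metric.isOpen_ball.measurableSet, setAverage_eq]
  exact (ae_tendsto_setAverage_ball hν).mono fun x hx => hx.congr (hratio x)

theorem deGiorgiNormal_withDensityᵥ_ae_eq : deGiorgiNormal (μ.withDensityᵥ ν) =ᵐ[μ] ν :=
  (ae_tendsto_ballRatio_withDensityᵥ hν hν1).mono fun _ hx => hx.limUnder_eq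

theorem ae_mem_reducedBoundary_withDensityᵥ : ∀ᵐ x ∂μ, x ∈ reducedBoundary (μ.withDensityᵥ ν) := by
  filter_upwards [ae_tendsto_ballRatio_withDensityᵥ hν hν1, hν1, μ.support_mem_ae] with x hx hx1 hxs
  exact ⟨by rwa [variation_withDensityᵥ_of_ae_norm_eq_one hν hν1], _, hx1, hx⟩

end DeGiorgiNormal

theorem reducedBoundary_subset_of_isClosed {n : ℕ} {D : VectorMeasure (Euc n) (Euc n)}
    {K : Set (Euc n)} (hK : IsClosed K) (hD : ∀ᵐ x ∂D.variation, x ∈ K) :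
    reducedBoundary D ⊆ K :=
  fun _ hx => Measure.support_subset_of_isClosed hK hD hx.1

/-! ### Domains that are Lipschitz at almost every boundary point -/

section AlmostLipschitz

variable {d : ℕ} {Ω : Set (Euc (d + 1))}

theorem isFiniteMeasure_boundaryMeasure (hfin : μHE[d] (frontier Ω) < ⊤) :
    IsFiniteMeasure (boundaryMeasure Ω) :=
  isFiniteMeasure_restrict.2 hfin.ne

theorem StokesFormula.isIndicatorGradient [IsFiniteMeasure (boundaryMeasure Ω)]
    {ν : Euc (d + 1) → Euc (d + 1)} (h : StokesFormula Ω ν) :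
    IsIndicatorGradient Ω ((boundaryMeasure Ω).withDensityᵥ ν) := fun u hu huc => by
  rw [h.2 u hu huc, integral_withDensityᵥ (innerSL ℝ) (h.1.integrable le_top)
    hu.continuous.stronglyMeasurable (hu.continuous.bounded_above_of_compact_support huc)]
  rfl

theorem ae_eq_normal_of_ae_eq_necasNormal {ν : Euc (d + 1) → Euc (d + 1)}
    (hν : ν =ᵐ[boundaryMeasure Ω] necasNormal Ω) {c : LipschitzChart d} (hc : c.IsChartOf Ω) :
    ∀ᵐ x ∂boundaryMeasure Ω, x ∈ c.U →
      DifferentiableAt ℝ c.φ (c.R x).fst ∧ ν x = c.normal x := by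
  filter_upwards [hν, LipschitzChart.ae_isNecasNormal hc] with x hx hxc hxU
  exact ⟨(hxc hxU).1, hx.trans (hxc hxU).2.necasNormal_eq⟩

theorem ae_tendsto_blowup_of_ae_eq_necasNormal (hΩ : MeasurableSet Ω)
    (hlip : ∀ᵐ x ∂boundaryMeasure Ω, IsLipschitzAt Ω x) {ν : Euc (d + 1) → Euc (d + 1)}
    (hν : ν =ᵐ[boundaryMeasure Ω] necasNormal Ω) :
    ∀ᵐ x ∂boundaryMeasure Ω, Tendsto (fun r : ℝ =>
      volume.real ((Ω ∆ {y | 0 < ⟪y - x, ν x⟫}) ∩ Metric.ball x r) / r ^ (d + 1))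
        (𝓝[>] 0) (𝓝 0) := by
  filter_upwards [hν, ae_exists_isNecasNormal hlip] with x hx hex
  have hN := isNecasNormal_necasNormal hex
  have hne : necasNormal Ω x ≠ 0 := norm_ne_zero_iff.1 (hN.norm_eq_one.trans_ne one_ne_zero)
  simpa only [hx, finrank_euclideanSpace_fin] using hN.isRayNormal.tendsto_blowup hΩ hne

theorem euclideanHausdorffMeasure_eq_zero_of_countable {X : Type*} [MetricSpace X]
    [MeasurableSpace X] [BorelSpace X] (hd : 0 < d) {s : Set X} (hs : s.Countable) :
    μHE[d] s = 0 := by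
  have := Measure.nullSingletonClass_hausdorff X (d := d) (by exact_mod_cast hd)
  rw [Measure.euclideanHausdorffMeasure_def, Measure.smul_apply, hs.measure_zero, smul_zero]

end AlmostLipschitz

theorem mainTheorem8_general {d : ℕ} {Ω : Set (Euc (d + 1))} (hΩ : MeasurableSet Ω)
    (hlip : ∀ᵐ x ∂boundaryMeasure Ω, IsLipschitzAt Ω x) (hfin : μHE[d] (frontier Ω) < ⊤) :
    (∃! D : VectorMeasure (Euc (d + 1)) (Euc (d + 1)), IsIndicatorGradient Ω D) ∧
    (∀ᵐ x ∂boundaryMeasure Ω, ∃! v : Euc (d + 1), IsNecasNormal Ω x v) ∧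
    ∀ D : VectorMeasure (Euc (d + 1)) (Euc (d + 1)), IsIndicatorGradient Ω D →
      D.variation = boundaryMeasure Ω ∧
      reducedBoundary D ⊆ frontier Ω ∧
      μHE[d] (frontier Ω \ reducedBoundary D) = 0 ∧
      deGiorgiNormal D =ᵐ[boundaryMeasure Ω] necasNormal Ω ∧
      (∀ c : LipschitzChart d, c.IsChartOf Ω → ∀ᵐ x ∂boundaryMeasure Ω, x ∈ c.U →
        DifferentiableAt ℝ c.φ (c.R x).fst ∧ deGiorgiNormal D x = c.normal x) ∧
      (∀ᵐ x ∂boundaryMeasure Ω, Tendsto (fun r : ℝ =>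
        volume.real ((Ω ∆ {y | 0 < ⟪y - x, deGiorgiNormal D x⟫}) ∩ Metric.ball x r)
          / r ^ (d + 1)) (𝓝[>] 0) (𝓝 0)) ∧
      StokesFormula Ω (deGiorgiNormal D) ∧
      StokesFormula Ω (necasNormal Ω) := by
  have := isFiniteMeasure_boundaryMeasure hfin
  have hStokes := stokesFormula_necasNormal hΩ hlip
  have hgrad := hStokes.isIndicatorGradient
  refine ⟨⟨_, hgrad, fun D hD => hD.unique hgrad⟩, ae_existsUnique_isNecasNormal hlip, ?_⟩
  intro D hD
  obtain rfl := hD.unique hgrad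
  have hint := hStokes.1.integrable le_top
  have hnorm := ae_norm_necasNormal hlip
  have hvar := variation_withDensityᵥ_of_ae_norm_eq_one hint hnorm
  have hnormal := deGiorgiNormal_withDensityᵥ_ae_eq hint hnorm
  exact ⟨hvar, reducedBoundary_subset_of_isClosed isClosed_frontier
      (by rw [hvar]; exact ae_restrict_mem isClosed_frontier.measurableSet),
    ae_boundaryMeasure_iff.1 (ae_mem_reducedBoundary_withDensityᵥ hint hnorm),
    hnormal, fun c hc => ae_eq_normal_of_ae_eq_necasNormal hnormal hc,
    ae_tendsto_blowup_of_ae_eq_necasNormal hΩ hlip hnormal, hStokes.congr hnormal.symm, hStokes⟩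

theorem mainTheorem8 :
    -- Lipschitz open sets: the two normals agree
    (∀ (d : ℕ) (Ω : Set (Euc (d + 1))), IsLipschitzOpen Ω →
      (μHE[d] : Measure (Euc (d + 1))) (frontier Ω) < ⊤ →
        (∃! D : VectorMeasure (Euc (d + 1)) (Euc (d + 1)), IsIndicatorGradient Ω D) ∧
        (∀ᵐ x ∂(boundaryMeasure Ω), ∃! v : Euc (d + 1), IsNecasNormal Ω x v) ∧
        ∀ D : VectorMeasure (Euc (d + 1)) (Euc (d + 1)), IsIndicatorGradient Ω D →
          D.variation = boundaryMeasure Ω ∧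
          reducedBoundary D ⊆ frontier Ω ∧
          (μHE[d] : Measure (Euc (d + 1))) (frontier Ω \ reducedBoundary D) = 0 ∧
          deGiorgiNormal D =ᵐ[boundaryMeasure Ω] necasNormal Ω ∧
          (∀ c : LipschitzChart d, c.IsChartOf Ω →
            ∀ᵐ x ∂(boundaryMeasure Ω), x ∈ c.U →
              DifferentiableAt ℝ c.φ (c.R x).fst ∧ deGiorgiNormal D x = c.normal x) ∧
          (∀ᵐ x ∂(boundaryMeasure Ω),
            Tendsto (fun r : ℝ =>
              volume.real ((Ω ∆ {y | 0 < ⟪y - x, deGiorgiNormal D x⟫}) ∩ Metric.ball x r)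
                / r ^ (d + 1)) (𝓝[>] 0) (𝓝 0)) ∧
          StokesFormula Ω (deGiorgiNormal D) ∧
          StokesFormula Ω (necasNormal Ω)) ∧
    -- finitely many singular boundary points, in dimension `d + 1 ≥ 2`
    (∀ (d : ℕ), 1 ≤ d → ∀ (Ω : Set (Euc (d + 1))) (S : Finset (Euc (d + 1))), IsOpen Ω →
      (∀ x ∈ frontier Ω, x ∉ S → IsLipschitzAt Ω x) →
      (μHE[d] : Measure (Euc (d + 1))) (frontier Ω) < ⊤ →
        (∀ᵐ x ∂(boundaryMeasure Ω), ∃! v : Euc (d + 1), IsNecasNormal Ω x v) ∧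
        StokesFormula Ω (necasNormal Ω)) := by
  refine ⟨fun d Ω hΩ => mainTheorem8_general hΩ.1.measurableSet
    (ae_restrict_of_forall_mem isClosed_frontier.measurableSet hΩ.2), fun d hd Ω S hΩ hS hfin => ?_⟩
  have hlip : ∀ᵐ x ∂boundaryMeasure Ω, IsLipschitzAt Ω x :=
    ae_boundaryMeasure_iff.2 <| measure_mono_null
      (fun x hx => of_not_not fun hxS => hx.2 (hS x hx.1 hxS))
      (euclideanHausdorffMeasure_eq_zero_of_countable hd S.countable_toSet)
  have := isFiniteMeasure_boundaryMeasure hfin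
  exact ⟨ae_existsUnique_isNecasNormal hlip, stokesFormula_necasNormal hΩ.measurableSet hlip⟩
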